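/- Let $n\ge 2$. A symmetric convex body in $\mathbb R^n$ is a compact convex set $K\subset\mathbb R^n$ with nonempty interior and $K=-K$; it is a body of revolution if, for some line through the origin (the axis), it is invariant under all orthogonal transformations of $\mathbb R^n$ that fix every point of the axis. For a star-shaped set $K\subset\mathbb R^n$ (with respect to the origin) the intersection body $IK$ is the star-shaped set with radial function $$\rho_{IK}(u)=\sup\{\lambda\ge 0:\lambda u\in IK\}=|K\cap u^\perp|_{n-1}\qquad (u\in S^{n-1}),$$ the supremum being attained, where $u^\perp$ is the hyperplane through the origin orthogonal to $u$ and $|\cdot|_{n-1}$ is $(n-1)$-dimensional Lebesgue measure; put $I^2K=I(IK)$. Let $B_2^n$ be the closed Euclidean unit ball of $\mathbb R^n$, and let $$d_{BM}(K,L)=\inf\{r\ge 1: K\subset TL\subset rK\text{ for some }T\in GL(n)\}$$ be the Banach--Mazur distance. Theorem. For every $\varepsilon>0$ there exists an integer $N>0$ such that for every $n\ge N$ and every symmetric convex body of revolution $K\subset\mathbb R^n$, $$d_{BM}(I^2K,B_2^n)\le 1+\varepsilon .$$ -/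

import Mathlib

open MeasureTheory

/-- A symmetric convex body in `ℝⁿ`: a compact convex set with nonempty interior and `K = -K`. -/
structure IsSymmetricConvexBody {n : ℕ} (K : Set (EuclideanSpace ℝ (Fin n))) : Prop where
  isCompact : IsCompact K
  convex : Convex ℝ K
  interior_nonempty : (interior K).Nonempty
  symmetric : ∀ x ∈ K, -x ∈ K

/-- `K` is a set of revolution about the line spanned by some unit vector `u`: membership of a
point depends only on its coordinate along the axis and on its distance to the origin
(equivalently, on its distance to the axis). -/
def IsOfRevolution {n : ℕ} (K : Set (EuclideanSpace ℝ (Fin n))) : Prop :=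
  ∃ u : EuclideanSpace ℝ (Fin n), ‖u‖ = 1 ∧
    ∀ x y, inner ℝ u x = inner ℝ u y → ‖x‖ = ‖y‖ → x ∈ K → y ∈ K

/-- The `(n-1)`-dimensional volume of the central section `K ∩ u^⊥` (used for `u ≠ 0`). The measure
`μHE[d]` is the `d`-dimensional Hausdorff measure, normalised to be Lebesgue measure on
`d`-dimensional subspaces. -/
noncomputable def sectionVolume {n : ℕ} (K : Set (EuclideanSpace ℝ (Fin n)))
    (u : EuclideanSpace ℝ (Fin n)) : ENNReal :=
  μHE[n - 1] (K ∩ {y | inner ℝ u y = 0})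

/-- The intersection body `I K`: the star-shaped set whose radial function at each unit vector `u`
is `|K ∩ u^⊥|`. A point `x = r u` with `r > 0` and `‖u‖ = 1` satisfies `x^⊥ = u^⊥`, so it lies in
`I K` if and only if `r ≤ |K ∩ u^⊥|`; the origin always lies in `I K`. -/
def intersectionBody {n : ℕ} (K : Set (EuclideanSpace ℝ (Fin n))) :
    Set (EuclideanSpace ℝ (Fin n)) :=
  {x | ENNReal.ofReal ‖x‖ ≤ sectionVolume K x}

/-- The radial function `ρ_K(u) = sup {r ≥ 0 : r u ∈ K}`. -/
noncomputable def radialFunction {n : ℕ} (K : Set (EuclideanSpace ℝ (Fin n)))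
    (u : EuclideanSpace ℝ (Fin n)) : ℝ :=
  sSup {r : ℝ | 0 ≤ r ∧ r • u ∈ K}

theorem sectionVolume_smul {n : ℕ} (K : Set (EuclideanSpace ℝ (Fin n)))
    (u : EuclideanSpace ℝ (Fin n)) {r : ℝ} (hr : r ≠ 0) :
    sectionVolume K (r • u) = sectionVolume K u := by
  simp [sectionVolume, inner_smul_left, hr]

theorem smul_mem_intersectionBody_iff {n : ℕ} (K : Set (EuclideanSpace ℝ (Fin n)))
    {u : EuclideanSpace ℝ (Fin n)} (hu : ‖u‖ = 1) {r : ℝ} (hr : 0 ≤ r) :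
    r • u ∈ intersectionBody K ↔ ENNReal.ofReal r ≤ sectionVolume K u := by
  rcases hr.eq_or_lt with rfl | h
  · simp [intersectionBody]
  · have hn : ‖r • u‖ = r := by rw [norm_smul, hu, mul_one, Real.norm_of_nonneg hr]
    change ENNReal.ofReal ‖r • u‖ ≤ sectionVolume K (r • u) ↔ _
    rw [hn, sectionVolume_smul K u h.ne']

/-- The defining property of the intersection body: `ρ_{I K}(u) = |K ∩ u^⊥|` for unit `u`. -/
theorem radialFunction_intersectionBody {n : ℕ} (K : Set (EuclideanSpace ℝ (Fin n)))
    {u : EuclideanSpace ℝ (Fin n)} (hu : ‖u‖ = 1) (hK : sectionVolume K u ≠ ⊤) :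
    radialFunction (intersectionBody K) u = (sectionVolume K u).toReal := by
  have h : {r : ℝ | 0 ≤ r ∧ r • u ∈ intersectionBody K}
      = Set.Icc 0 (sectionVolume K u).toReal := by
    ext r
    simp only [Set.mem_ofPred_eq, Set.mem_Icc]
    refine and_congr_right fun hr => ?_
    rw [smul_mem_intersectionBody_iff K hu hr, ENNReal.ofReal_le_iff_le_toReal hK]
  rw [radialFunction, h, csSup_Icc ENNReal.toReal_nonneg]

/-- The Banach-Mazur distance
`d_BM(K, L) = inf {r ≥ 1 : K ⊆ T L ⊆ r K for some T ∈ GL(n)}`, with values in `[0, ∞]`, so that the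
infimum over the empty set is `∞`. -/
noncomputable def banachMazurDist {n : ℕ} (K L : Set (EuclideanSpace ℝ (Fin n))) : ENNReal :=
  sInf {d : ENNReal | ∃ r : ℝ, 1 ≤ r ∧ d = ENNReal.ofReal r ∧
    ∃ T : EuclideanSpace ℝ (Fin n) ≃ₗ[ℝ] EuclideanSpace ℝ (Fin n),
      K ⊆ T '' L ∧ T '' L ⊆ (fun x => r • x) '' K}

/-!
The intersection body of a body of revolution is computed by a one-dimensional transform, and
applying this transform twice in high dimension produces the profile of an ellipsoid.

Let `e` be the axis and write `t = ⟪e, x⟫`, `r` for the distance of `x` to the axis, `b = t / r`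
for the slope of `x`. A body of revolution is given off the axis by `r ≤ Φ b` (`HasSlopeProfile`).
Parametrising the points of a hyperplane section by their slope turns its volume into an integral of
`Φ ^ (n - 1)` (`sectionVolume_eq_of_hasSlopeProfile`), and a substitution shows that the
intersection body has the profile `b ↦ C ∫ Φ(a) ^ (n - 1) (1 - a² b²)₊ ^ ((n - 4) / 2) da`
(`HasSlopeProfile.intersectionBody`). This transform maps the profile `(1 + q b²) ^ (-1/2)` of an
ellipsoid to a profile of the same type (`lintegral_ellipsoid`).

For a convex body `K`, `Φ = 1 / g` with `g` even and convex. After rescaling the slope, the density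
`D = g ^ (-(n - 1))` is at least `e⁻¹` on `[-1, 1]` and bounded by a multiple of `(1 + a²) ^ (-3)`
that does not depend on `K` or `n` (`tameDensity_inv_pow`), so its second and fourth moments are
comparable. With `j = n - 4` and `σ² = ∫ a² D / ∫ D`, the normalised profile `w` of `I K`
therefore satisfies `w = 1 - j σ² b² / 2 + O((j σ² b²)²)`, together with a decay estimate for large
slopes (`exists_nearEllipsoidProfile`). The second intersection body depends on `w ^ (n - 1)`. As
`n` grows, this power is concentrated where `j σ² b²` is small, and there `w` is close to the
profile `(1 + j σ² b²) ^ (-1/2)` of an ellipsoid. The lower bound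
(`NearEllipsoidProfile.le_lintegral`) holds without error by Bernoulli's inequality. In the upper
bound (`NearEllipsoidProfile.lintegral_le`), the slopes with `j σ² b²` bounded below contribute an
exponentially small term, since `w` stays below the profile of another ellipsoid there.
-/

/-! ### Changes of variables on the line -/

theorem lintegral_comp_const_mul (g : ℝ → ENNReal) {c : ℝ} (hc : 0 < c) :
    ∫⁻ x, g (c * x) = ENNReal.ofReal c⁻¹ * ∫⁻ x, g x := by
  have h := lintegral_image_eq_lintegral_abs_deriv_mul (f := fun x : ℝ => c⁻¹ * x)
    (f' := fun _ => c⁻¹) MeasurableSet.univ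
    (fun x _ => by simpa using (hasDerivAt_id' x).const_mul c⁻¹)
    (fun x _ y _ hxy => by simpa [hc.ne'] using hxy) (fun y => g (c * y))
  have him : (fun x : ℝ => c⁻¹ * x) '' Set.univ = Set.univ := by
    rw [Set.image_univ, Set.range_eq_univ]
    exact fun y => ⟨c * y, by field_simp⟩
  rw [him] at h
  simp only [Measure.restrict_univ, abs_of_pos (inv_pos.2 hc), mul_inv_cancel_left₀ hc.ne'] at h
  rw [h, lintegral_const_mul' _ _ ENNReal.ofReal_ne_top]

/-- The substitution `a = x / √(1 + c² x²)`, which maps `ℝ` onto `{a | a² c² < 1}`. The right-hand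
integrand vanishes off that set, because `Real.sqrt` of a negative number is `0`. -/
theorem lintegral_slope_subst (G : ℝ → ENNReal) (c : ℝ) {j : ℕ} (hj : j ≠ 0) :
    ∫⁻ x, G (x / √(1 + x ^ 2 * c ^ 2)) * ENNReal.ofReal ((√(1 + x ^ 2 * c ^ 2))⁻¹ ^ (j + 3))
      = ∫⁻ a, G a * ENNReal.ofReal (√(1 - a ^ 2 * c ^ 2) ^ j) := by
  set s : Set ℝ := {a | 0 < 1 - a ^ 2 * c ^ 2} with hs
  have hsm : MeasurableSet s := measurableSet_lt measurable_const (by fun_prop)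
  have hsq : ∀ a ∈ s, √(1 + (a / √(1 - a ^ 2 * c ^ 2)) ^ 2 * c ^ 2)
      = (√(1 - a ^ 2 * c ^ 2))⁻¹ := by
    intro a (ha : 0 < 1 - a ^ 2 * c ^ 2)
    rw [← Real.sqrt_inv]
    congr 1
    rw [div_pow, Real.sq_sqrt ha.le]
    field_simp
    ring
  have hinv : ∀ a ∈ s, a / √(1 - a ^ 2 * c ^ 2)
      / √(1 + (a / √(1 - a ^ 2 * c ^ 2)) ^ 2 * c ^ 2) = a := by
    intro a ha
    rw [hsq a ha]
    have := Real.sqrt_pos.2 ha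
    field_simp
  have him : (fun a => a / √(1 - a ^ 2 * c ^ 2)) '' s = Set.univ := by
    refine Set.eq_univ_of_forall fun x => ?_
    have hx : 0 < 1 + x ^ 2 * c ^ 2 := by positivity
    have h1 : 1 - (x / √(1 + x ^ 2 * c ^ 2)) ^ 2 * c ^ 2 = (1 + x ^ 2 * c ^ 2)⁻¹ := by
      rw [div_pow, Real.sq_sqrt hx.le]
      field_simp
      ring
    refine ⟨x / √(1 + x ^ 2 * c ^ 2), ?_, ?_⟩
    · simp only [hs, Set.mem_ofPred_eq, h1]
      positivity
    · simp only [h1, Real.sqrt_inv]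
      have := Real.sqrt_pos.2 hx
      field_simp
  have key := lintegral_image_eq_lintegral_abs_deriv_mul
    (f := fun a => a / √(1 - a ^ 2 * c ^ 2))
    (f' := fun a => (√(1 - a ^ 2 * c ^ 2))⁻¹ ^ 3) hsm
    (fun a (ha : 0 < 1 - a ^ 2 * c ^ 2) => by
      have hu := Real.sqrt_pos.2 ha
      have h1 : HasDerivAt (fun a : ℝ => 1 - a ^ 2 * c ^ 2) (-(2 * a * c ^ 2)) a := by
        simpa using ((hasDerivAt_pow 2 a).mul_const (c ^ 2)).const_sub 1
      have h2 := (hasDerivAt_id a).div (h1.sqrt ha.ne') hu.ne'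
      refine HasDerivAt.hasDerivWithinAt ?_
      refine HasDerivAt.congr_deriv (f := fun a => a / √(1 - a ^ 2 * c ^ 2)) h2 ?_
      have h3 := Real.sq_sqrt ha.le
      simp only [id]
      field_simp
      rw [h3]
      ring)
    (fun a ha b hb hab => by
      beta_reduce at hab
      rw [← hinv a ha, ← hinv b hb, hab])
    (fun x => G (x / √(1 + x ^ 2 * c ^ 2)) * ENNReal.ofReal ((√(1 + x ^ 2 * c ^ 2))⁻¹ ^ (j + 3)))
  rw [him, Measure.restrict_univ] at key
  rw [key, ← lintegral_indicator hsm]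
  congr 1
  ext a
  by_cases ha : a ∈ s
  · rw [Set.indicator_of_mem ha, hinv a ha, hsq a ha, inv_inv, mul_left_comm,
      ← ENNReal.ofReal_mul (abs_nonneg _)]
    congr 2
    have := Real.sqrt_pos.2 ha
    rw [abs_of_nonneg (by positivity)]
    field_simp
    ring
  · rw [Set.indicator_of_notMem ha, Real.sqrt_eq_zero_of_nonpos (not_lt.1 ha), zero_pow hj]
    simp

/-! ### Elementary inequalities -/

/-- The Bernoulli inequality for `(1 - x)₊ ^ (j / 2)`. -/
theorem one_sub_le_sqrt_pow {x : ℝ} {j : ℕ} (hj : 2 ≤ j) :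
    1 - j / 2 * x ≤ √(1 - x) ^ j := by
  rcases le_or_gt x 1 with h | h
  · have h2 : (1 : ℝ) ≤ j / 2 := by
      have : (2 : ℝ) ≤ j := by exact_mod_cast hj
      linarith
    have := one_add_mul_self_le_rpow_one_add (s := -x) (by linarith) h2
    rw [Real.sqrt_eq_rpow, ← Real.rpow_natCast, ← Real.rpow_mul (by linarith)]
    calc 1 - j / 2 * x = 1 + j / 2 * -x := by ring
      _ ≤ _ := this
      _ = (1 - x) ^ (1 / 2 * (j : ℝ)) := by ring_nf
  · have : (2 : ℝ) ≤ j := by exact_mod_cast hj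
    have h0 : 1 - j / 2 * x ≤ 0 := by nlinarith
    exact h0.trans (by positivity)

/-- Since `(1 - x) ^ (j / 2) (1 + x) ^ (j / 2) ≤ 1`, this is Bernoulli's inequality for the second
factor. -/
theorem sqrt_pow_le_inv {x : ℝ} (hx : 0 ≤ x) {j : ℕ} (hj : 2 ≤ j) :
    √(1 - x) ^ j ≤ (1 + j / 2 * x)⁻¹ := by
  have hp : 0 < 1 + j / 2 * x := by positivity
  have hj0 : j ≠ 0 := by omega
  rw [← one_div, le_div_iff₀ hp]
  rcases le_or_gt x 1 with h | h
  · have h2 : (1 : ℝ) ≤ j / 2 := by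
      have : (2 : ℝ) ≤ j := by exact_mod_cast hj
      linarith
    have h3 : 1 + j / 2 * x ≤ √(1 + x) ^ j := by
      have := one_add_mul_self_le_rpow_one_add (s := x) (by linarith) h2
      rw [Real.sqrt_eq_rpow, ← Real.rpow_natCast, ← Real.rpow_mul (by linarith)]
      convert this using 2
      ring
    calc √(1 - x) ^ j * (1 + j / 2 * x) ≤ √(1 - x) ^ j * √(1 + x) ^ j := by gcongr
      _ = √(1 - x ^ 2) ^ j := by
        rw [← mul_pow, ← Real.sqrt_mul (by linarith)]
        ring_nf
      _ ≤ 1 := pow_le_one₀ (Real.sqrt_nonneg _) (Real.sqrt_le_one.2 (by nlinarith))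
  · rw [Real.sqrt_eq_zero_of_nonpos (by linarith), zero_pow hj0]
    simp

/-- A second form of the Bernoulli inequality: `(1 - d x) ^ (j / 2) ≤ (1 - (j / 2) x) ^ d`. -/
theorem sqrt_pow_le_pow {x : ℝ} (hx : 0 ≤ x) {j d : ℕ} (hj : 0 < j) (hd : j ≤ 2 * d)
    (hx1 : d * x ≤ 1) : √(1 - d * x) ^ j ≤ (1 - j / 2 * x) ^ d := by
  have hj' : (0 : ℝ) < j := by exact_mod_cast hj
  have hd' : (j : ℝ) ≤ 2 * d := by exact_mod_cast hd
  have h1 : (j : ℝ) / 2 * x ≤ 1 := le_trans (by nlinarith) hx1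
  have hp : (1 : ℝ) ≤ 2 * d / j := by rwa [le_div_iff₀ hj', one_mul]
  have := one_add_mul_self_le_rpow_one_add (s := -(j / 2 * x)) (by linarith) hp
  have h2 : 1 - d * x ≤ (1 - j / 2 * x) ^ (2 * d / j : ℝ) := by
    refine le_trans (le_of_eq ?_) (this.trans (le_of_eq ?_))
    · field_simp
      ring
    · ring_nf
  have h3 : (0 : ℝ) ≤ 1 - j / 2 * x := by linarith
  rw [Real.sqrt_eq_rpow, ← Real.rpow_natCast, ← Real.rpow_mul (by linarith)]
  refine (Real.rpow_le_rpow (by linarith) h2 (by positivity)).trans (le_of_eq ?_)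
  rw [← Real.rpow_mul h3, ← Real.rpow_natCast]
  congr 1
  field_simp

/-! ### Moments of a density with polynomial decay -/

/-- A density `D` on the line that is at least `e⁻¹` on `[-1, 1]` and bounded by
`B / (1 + a²)³`. Its moments up to order four are controlled in terms of `B` alone. -/
structure TameDensity (B : ℝ) (D : ℝ → ℝ) : Prop where
  measurable : Measurable D
  nonneg : ∀ a, 0 ≤ D a
  le : ∀ a, D a ≤ B * (1 + a ^ 2)⁻¹ ^ 3
  ge : ∀ a, |a| ≤ 1 → Real.exp (-1) ≤ D a

/-- The transform `b ↦ ∫ D(a) (1 - a² b²)₊ ^ (j / 2) da`, which expresses the section volumes of a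
body of revolution through its profile. -/
noncomputable def sectionTransform (j : ℕ) (D : ℝ → ℝ) (b : ℝ) : ℝ :=
  ∫ a, D a * √(1 - a ^ 2 * b ^ 2) ^ j

theorem sqrt_one_sub_pow_le_one (a b : ℝ) (j : ℕ) : √(1 - a ^ 2 * b ^ 2) ^ j ≤ 1 :=
  pow_le_one₀ (Real.sqrt_nonneg _) (Real.sqrt_le_one.2 (by nlinarith [sq_nonneg (a * b)]))

theorem sectionTransform_zero (j : ℕ) (D : ℝ → ℝ) : sectionTransform j D 0 = ∫ a, D a := by
  simp [sectionTransform]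

theorem integrable_mul_sqrt_pow {D : ℝ → ℝ} (hD : Integrable D) (j : ℕ) (b : ℝ) :
    Integrable fun a => D a * √(1 - a ^ 2 * b ^ 2) ^ j := by
  refine hD.mul_bdd (c := 1) (by fun_prop) (Filter.Eventually.of_forall fun a => ?_)
  rw [Real.norm_of_nonneg (by positivity)]
  exact sqrt_one_sub_pow_le_one a b j

theorem sectionTransform_nonneg {D : ℝ → ℝ} (hD : ∀ a, 0 ≤ D a) (j : ℕ) (b : ℝ) :
    0 ≤ sectionTransform j D b :=
  integral_nonneg fun a => mul_nonneg (hD a) (by positivity)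

theorem measurable_sectionTransform {D : ℝ → ℝ} (hD : Measurable D) (j : ℕ) :
    Measurable (sectionTransform j D) := by
  have h : StronglyMeasurable
      (Function.uncurry fun b a : ℝ => D a * √(1 - a ^ 2 * b ^ 2) ^ j) := by
    apply Measurable.stronglyMeasurable
    unfold Function.uncurry
    fun_prop
  exact h.integral_prod_right.measurable

theorem sectionTransform_anti {D : ℝ → ℝ} (hD : ∀ a, 0 ≤ D a) (hi : Integrable D) (j : ℕ)
    {b b' : ℝ} (h : b ^ 2 ≤ b' ^ 2) : sectionTransform j D b' ≤ sectionTransform j D b := by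
  refine integral_mono (integrable_mul_sqrt_pow hi j b') (integrable_mul_sqrt_pow hi j b)
    fun a => mul_le_mul_of_nonneg_left ?_ (hD a)
  gcongr

namespace TameDensity

variable {B : ℝ} {D : ℝ → ℝ}

theorem bound_pos (h : TameDensity B D) : 0 < B := by
  have h0 := h.ge 0 (by simp)
  have h1 := h.le 0
  have := Real.exp_pos (-1)
  norm_num at h1
  linarith

theorem pow_mul_le (h : TameDensity B D) {i : ℕ} (hi : i ≤ 2) (a : ℝ) :
    (a ^ 2) ^ i * D a ≤ B * (1 + a ^ 2)⁻¹ := by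
  have hB := h.bound_pos
  have h1 : (1 : ℝ) ≤ 1 + a ^ 2 := by nlinarith [sq_nonneg a]
  have h2 : (a ^ 2) ^ i ≤ (1 + a ^ 2) ^ 2 :=
    (pow_le_pow_left₀ (sq_nonneg a) (by linarith) i).trans (pow_le_pow_right₀ h1 hi)
  calc (a ^ 2) ^ i * D a ≤ (1 + a ^ 2) ^ 2 * (B * (1 + a ^ 2)⁻¹ ^ 3) :=
        mul_le_mul h2 (h.le a) (h.nonneg a) (by positivity)
    _ = B * (1 + a ^ 2)⁻¹ := by field_simp

theorem integrable_moment (h : TameDensity B D) {i : ℕ} (hi : i ≤ 2) :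
    Integrable fun a => (a ^ 2) ^ i * D a := by
  have hm := h.measurable
  refine (integrable_inv_one_add_sq.const_mul B).mono' (by fun_prop)
    (Filter.Eventually.of_forall fun a => ?_)
  rw [Real.norm_of_nonneg (mul_nonneg (by positivity) (h.nonneg a))]
  exact h.pow_mul_le hi a

theorem integrable (h : TameDensity B D) : Integrable D := by
  simpa using h.integrable_moment (i := 0) (by norm_num)

theorem moment_le (h : TameDensity B D) {i : ℕ} (hi : i ≤ 2) :
    ∫ a, (a ^ 2) ^ i * D a ≤ B * Real.pi := by
  rw [← integral_univ_inv_one_add_sq, ← integral_const_mul]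
  exact integral_mono (h.integrable_moment hi) (integrable_inv_one_add_sq.const_mul B)
    (h.pow_mul_le hi)

theorem le_moment (h : TameDensity B D) {i : ℕ} (hi : i ≤ 2) :
    1 / 10 ≤ ∫ a, (a ^ 2) ^ i * D a := by
  have h0 : (∫ a in (-1 : ℝ)..1, (a ^ 2) ^ i * Real.exp (-1))
      = 2 / (2 * i + 1) * Real.exp (-1) := by
    rw [intervalIntegral.integral_mul_const]
    simp_rw [← pow_mul]
    rw [integral_pow, Odd.neg_one_pow ⟨i, rfl⟩]
    push_cast
    ring
  have h1 : (∫ a in (-1 : ℝ)..1, (a ^ 2) ^ i * Real.exp (-1)) ≤ ∫ a, (a ^ 2) ^ i * D a := by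
    rw [intervalIntegral.integral_of_le (by norm_num)]
    refine (setIntegral_mono_on ?_ (h.integrable_moment hi).integrableOn measurableSet_Ioc
      fun a ha => ?_).trans (setIntegral_le_integral (h.integrable_moment hi)
        (Filter.Eventually.of_forall fun a => mul_nonneg (by positivity) (h.nonneg a)))
    · exact (Continuous.integrableOn_Icc (by fun_prop)).mono_set Set.Ioc_subset_Icc_self
    · exact mul_le_mul_of_nonneg_left (h.ge a (abs_le.2 ⟨ha.1.le, ha.2⟩)) (by positivity)
  refine le_trans ?_ (h0 ▸ h1)
  have h2 : (1 : ℝ) / 3 ≤ Real.exp (-1) := by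
    rw [Real.exp_neg, ← one_div]
    exact one_div_le_one_div_of_le (Real.exp_pos 1) (by linarith [Real.exp_one_lt_d9])
  have h3 : (i : ℝ) ≤ 2 := by exact_mod_cast hi
  have h4 : (2 : ℝ) / 5 ≤ 2 / (2 * i + 1) := by
    gcongr
    linarith
  calc (1 : ℝ) / 10 ≤ 2 / 5 * (1 / 3) := by norm_num
    _ ≤ _ := by gcongr

end TameDensity

/-! ### The profile of an intersection body near and away from slope zero -/

namespace TameDensity

variable {B : ℝ} {D : ℝ → ℝ}

theorem integral_pos (h : TameDensity B D) : 0 < ∫ a, D a := by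
  have := h.le_moment (i := 0) (by norm_num)
  simp at this
  linarith

theorem sectionTransform_lower (h : TameDensity B D) {j : ℕ} (hj : 2 ≤ j) (b : ℝ) :
    (∫ a, D a) - j / 2 * b ^ 2 * ∫ a, a ^ 2 * D a ≤ sectionTransform j D b := by
  have h1 : Integrable fun a => a ^ 2 * D a := by
    simpa using h.integrable_moment (i := 1) (by norm_num)
  rw [← integral_const_mul, ← integral_sub h.integrable (h1.const_mul _)]
  refine integral_mono (h.integrable.sub (h1.const_mul _))
    (integrable_mul_sqrt_pow h.integrable j b) fun a => ?_
  have := mul_le_mul_of_nonneg_left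
    (one_sub_le_sqrt_pow (x := a ^ 2 * b ^ 2) hj) (h.nonneg a)
  beta_reduce
  linarith

theorem sectionTransform_upper (h : TameDensity B D) {j : ℕ} (hj : 2 ≤ j) (b : ℝ) :
    sectionTransform j D b ≤ (∫ a, D a) - j / 2 * b ^ 2 * (∫ a, a ^ 2 * D a)
      + (j / 2 * b ^ 2) ^ 2 * ∫ a, (a ^ 2) ^ 2 * D a := by
  have h1 : Integrable fun a => a ^ 2 * D a := by
    simpa using h.integrable_moment (i := 1) (by norm_num)
  have h2 := h.integrable_moment (i := 2) (by norm_num)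
  rw [← integral_const_mul, ← integral_const_mul, ← integral_sub h.integrable (h1.const_mul _),
    ← integral_add (f := fun a => D a - j / 2 * b ^ 2 * (a ^ 2 * D a))
      (h.integrable.sub (h1.const_mul _)) (h2.const_mul _)]
  refine integral_mono (integrable_mul_sqrt_pow h.integrable j b)
    ((h.integrable.sub (h1.const_mul _)).add (h2.const_mul _)) fun a => ?_
  have hu : 0 ≤ (j : ℝ) / 2 * (a ^ 2 * b ^ 2) := by positivity
  have h3 : (1 + (j : ℝ) / 2 * (a ^ 2 * b ^ 2))⁻¹ ≤ 1 - (j : ℝ) / 2 * (a ^ 2 * b ^ 2)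
      + ((j : ℝ) / 2 * (a ^ 2 * b ^ 2)) ^ 2 := by
    set u := (j : ℝ) / 2 * (a ^ 2 * b ^ 2)
    rw [inv_le_iff_one_le_mul₀ (by positivity)]
    nlinarith [pow_nonneg hu 3]
  have := mul_le_mul_of_nonneg_left
    ((sqrt_pow_le_inv (x := a ^ 2 * b ^ 2) (by positivity) hj).trans h3) (h.nonneg a)
  beta_reduce
  linarith

/-- The transform decays at least like `1 / (√j |b|)`, because the density is bounded. -/
theorem sectionTransform_decay (h : TameDensity B D) {j : ℕ} (hj : 2 ≤ j) (b : ℝ) :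
    j * b ^ 2 * sectionTransform j D b ^ 2 ≤ 2 * (B * Real.pi) ^ 2 := by
  have hB := h.bound_pos
  rcases eq_or_ne b 0 with rfl | hb
  · simp
    positivity
  have hj0 : (0 : ℝ) < j := by
    have : 0 < j := by omega
    exact_mod_cast this
  set s : ℝ := √(j / 2 * b ^ 2) with hs
  have hs0 : 0 < s := Real.sqrt_pos.2 (by positivity)
  have hs2 : s ^ 2 = j / 2 * b ^ 2 := Real.sq_sqrt (by positivity)
  have hint : Integrable fun a => (1 + (s * a) ^ 2)⁻¹ :=
    integrable_inv_one_add_sq.comp_mul_left' hs0.ne'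
  have h1 : sectionTransform j D b ≤ B * (s⁻¹ * Real.pi) := by
    have h2 : ∫ a, (1 + (s * a) ^ 2)⁻¹ = s⁻¹ * Real.pi := by
      rw [Measure.integral_comp_mul_left (fun a : ℝ => (1 + a ^ 2)⁻¹) s,
        integral_univ_inv_one_add_sq, abs_of_pos (inv_pos.2 hs0), smul_eq_mul]
    rw [← h2, ← integral_const_mul]
    refine integral_mono (integrable_mul_sqrt_pow h.integrable j b) (hint.const_mul B) fun a => ?_
    have h3 : D a ≤ B := by
      refine (h.le a).trans (mul_le_of_le_one_right hB.le (pow_le_one₀ (by positivity) ?_))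
      exact inv_le_one_of_one_le₀ (by nlinarith [sq_nonneg a])
    have h4 := sqrt_pow_le_inv (x := a ^ 2 * b ^ 2) (by positivity) hj
    rw [show (j : ℝ) / 2 * (a ^ 2 * b ^ 2) = (s * a) ^ 2 by rw [mul_pow, hs2]; ring] at h4
    exact mul_le_mul h3 h4 (by positivity) hB.le
  have h5 := sectionTransform_nonneg h.nonneg j b
  calc j * b ^ 2 * sectionTransform j D b ^ 2
      = 2 * (s * sectionTransform j D b) ^ 2 := by rw [mul_pow, hs2]; ring
    _ ≤ 2 * (s * (B * (s⁻¹ * Real.pi))) ^ 2 := by gcongr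
    _ = 2 * (B * Real.pi) ^ 2 := by field_simp

end TameDensity

/-- The estimates that make the profile `w` of an intersection body, normalised by `w 0 = 1`,
comparable with the profile `(1 + j v b²) ^ (-1/2)` of an ellipsoid, where `v` stands for the
variance `σ²`: a lower bound that is sharp to second order at `b = 0`, an almost sharp upper bound
where `j v b² ≤ η`, and a weaker upper bound beyond. -/
structure NearEllipsoidProfile (j : ℕ) (δ η κ v : ℝ) (w : ℝ → ℝ) : Prop where
  measurable : Measurable w
  nonneg : ∀ b, 0 ≤ w b
  lower : ∀ b, 1 - j / 2 * (v * b ^ 2) ≤ w b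
  near : ∀ b, j * v * b ^ 2 ≤ η → w b ^ 2 * (1 + (1 - δ) * (j * v * b ^ 2)) ≤ 1
  far : ∀ b, η ≤ j * v * b ^ 2 → w b ^ 2 * (1 + κ * (j * v * b ^ 2)) ≤ 1

set_option maxHeartbeats 400000 in
/-- The transform of a tame density is a nearly ellipsoidal profile, with constants `η`, `κ` that do
not depend on `j` or on the density. Near slope `0` this compares the second and fourth moments;
beyond, it uses monotonicity of the transform and its decay like `1 / |b|`. -/
theorem exists_nearEllipsoidProfile (B : ℝ) {δ : ℝ} (hδ : 0 < δ) (hδ1 : δ < 1) :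
    ∃ η > 0, ∃ κ > 0, ∀ (j : ℕ) (D : ℝ → ℝ), 2 ≤ j → TameDensity B D →
      ∃ v > 0, NearEllipsoidProfile j δ η κ v
        (fun b => sectionTransform j D b / sectionTransform j D 0) := by
  by_cases hB : 0 < B
  swap
  · exact ⟨1, one_pos, 1, one_pos, fun j D _ h => absurd h.bound_pos hB⟩
  set P : ℝ := B * Real.pi with hP
  have hP0 : 0 < P := by positivity
  -- for `z ≤ δ / (1000 P³)`, the fourth-moment term is at most `δ` times the second-moment one
  set η : ℝ := min 1 (δ / (1000 * P ^ 3)) with hη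
  have hη0 : 0 < η := by positivity
  -- `w² ≤ C / z` with `z = j v b²`, so `w² (1 + κ z) ≤ 1` beyond `2 C` as soon as `κ ≤ 1 / (2 C)`
  set C : ℝ := 2000 * P ^ 3 with hC
  have hC0 : 0 < C := by positivity
  set κ : ℝ := min ((1 - δ) * η / (2 * C)) (1 / (2 * C)) with hκ
  have hκ0 : 0 < κ := by
    have : 0 < 1 - δ := by linarith
    positivity
  refine ⟨η, hη0, κ, hκ0, fun j D hj h => ?_⟩
  have hj0 : (0 : ℝ) < j := by
    have : 0 < j := by omega
    exact_mod_cast this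
  set Z : ℝ := ∫ a, D a with hZ
  set m₂ : ℝ := ∫ a, a ^ 2 * D a with hm2
  set m₄ : ℝ := ∫ a, (a ^ 2) ^ 2 * D a with hm4
  have hZl : 1 / 10 ≤ Z := by simpa using h.le_moment (i := 0) (by norm_num)
  have hZu : Z ≤ P := by simpa using h.moment_le (i := 0) (by norm_num)
  have h2l : 1 / 10 ≤ m₂ := by simpa using h.le_moment (i := 1) (by norm_num)
  have h2u : m₂ ≤ P := by simpa using h.moment_le (i := 1) (by norm_num)
  have h4u : m₄ ≤ P := by simpa using h.moment_le (i := 2) (by norm_num)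
  have hZ0 : 0 < Z := by linarith
  have h20 : 0 < m₂ := by linarith
  have hw0 := fun b => sectionTransform_nonneg h.nonneg j b
  have hlow := fun b => h.sectionTransform_lower hj b
  have hup := fun b => h.sectionTransform_upper hj b
  have hdec := fun b => h.sectionTransform_decay hj b
  have near : ∀ b, j * (m₂ / Z) * b ^ 2 ≤ η → (sectionTransform j D b / Z) ^ 2 *
      (1 + (1 - δ) * (j * (m₂ / Z) * b ^ 2)) ≤ 1 := by
    intro b hb
    set z := j * (m₂ / Z) * b ^ 2 with hz
    have hz0 : 0 ≤ z := by positivity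
    have hz1 : z ≤ 1 := hb.trans (min_le_left _ _)
    have hzδ : z * (1000 * P ^ 3) ≤ δ := by
      rw [← le_div_iff₀ (by positivity)]
      exact hb.trans (min_le_right _ _)
    have hq : j / 2 * b ^ 2 = z / 2 * (Z / m₂) := by rw [hz]; field_simp
    have hw : sectionTransform j D b / Z ≤ 1 - (1 - δ) * z / 2 := by
      rw [div_le_iff₀ hZ0]
      refine (hup b).trans ?_
      rw [hq]
      have e1 : z / 2 * (Z / m₂) * m₂ = z / 2 * Z := by field_simp
      have e2 : (z / 2 * (Z / m₂)) ^ 2 * m₄ = z / 4 * (z * (Z / m₂) * (m₄ / m₂)) * Z := by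
        field_simp
        ring
      have e3 : z * (Z / m₂) * (m₄ / m₂) ≤ 2 * δ := by
        have a1 : Z / m₂ ≤ 10 * P := by rw [div_le_iff₀ h20]; nlinarith
        have a2 : m₄ / m₂ ≤ 10 * P := by rw [div_le_iff₀ h20]; nlinarith
        have a3 : 1 ≤ 10 * P := by linarith
        have a4 : 0 ≤ m₄ / m₂ :=
          div_nonneg (integral_nonneg fun a => mul_nonneg (by positivity) (h.nonneg a)) h20.le
        calc z * (Z / m₂) * (m₄ / m₂) ≤ z * (10 * P) * (10 * P) := by gcongr
          _ ≤ z * (10 * P) * (10 * P) * (10 * P) := le_mul_of_one_le_right (by positivity) a3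
          _ = z * (1000 * P ^ 3) := by ring
          _ ≤ 2 * δ := by linarith
      rw [e1, e2]
      have e4 : z / 4 * (z * (Z / m₂) * (m₄ / m₂)) * Z ≤ z / 4 * (2 * δ) * Z := by gcongr
      linarith
    have hw' : 0 ≤ sectionTransform j D b / Z := div_nonneg (hw0 b) hZ0.le
    set y := (1 - δ) * z with hy
    have hy0 : 0 ≤ y := mul_nonneg (by linarith) hz0
    have hy1 : y ≤ 1 := by nlinarith
    calc (sectionTransform j D b / Z) ^ 2 * (1 + y) ≤ (1 - y / 2) ^ 2 * (1 + y) := by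
          gcongr
      _ ≤ 1 := by nlinarith [mul_nonneg hy0 hy0]
  refine ⟨m₂ / Z, by positivity, ?_⟩
  rw [sectionTransform_zero]
  refine ⟨(measurable_sectionTransform h.measurable j).div_const _,
    fun b => div_nonneg (hw0 b) hZ0.le, fun b => ?_, near, fun b hb => ?_⟩
  · rw [le_div_iff₀ hZ0]
    refine le_trans (le_of_eq ?_) (hlow b)
    rw [← hZ, ← hm2]
    field_simp
  · set z := j * (m₂ / Z) * b ^ 2 with hz
    have hz0 : 0 < z := hη0.trans_le hb
    have hw' : 0 ≤ sectionTransform j D b / Z := div_nonneg (hw0 b) hZ0.le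
    rcases le_total z (2 * C) with hzC | hzC
    · -- compare with the point where `z = η`
      set b₀ := √(η / (j * (m₂ / Z))) with hb0
      have hb02 : b₀ ^ 2 = η / (j * (m₂ / Z)) := Real.sq_sqrt (by positivity)
      have e1 : j * (m₂ / Z) * b₀ ^ 2 = η := by rw [hb02]; field_simp
      have e2 := near b₀ e1.le
      rw [e1] at e2
      have e3 : b₀ ^ 2 ≤ b ^ 2 := by
        rw [hb02, div_le_iff₀ (by positivity), mul_comm]
        exact hb
      have e4 := sectionTransform_anti h.nonneg h.integrable j e3
      have e5 : κ * z ≤ (1 - δ) * η := by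
        calc κ * z ≤ (1 - δ) * η / (2 * C) * (2 * C) :=
              mul_le_mul (min_le_left _ _) hzC hz0.le (by
                have : 0 < 1 - δ := by linarith
                positivity)
          _ = (1 - δ) * η := by field_simp
      calc (sectionTransform j D b / Z) ^ 2 * (1 + κ * z)
          ≤ (sectionTransform j D b₀ / Z) ^ 2 * (1 + (1 - δ) * η) := by gcongr
        _ ≤ 1 := e2
    · have e1 : (sectionTransform j D b / Z) ^ 2 * z ≤ C := by
        have e2 : (sectionTransform j D b / Z) ^ 2 * z
            = (j * b ^ 2 * sectionTransform j D b ^ 2) * (m₂ / Z ^ 3) := by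
          rw [hz]; field_simp
        have e3 : m₂ / Z ^ 3 ≤ 1000 * P := by
          rw [div_le_iff₀ (by positivity)]
          have : (1 / 10 : ℝ) ^ 3 ≤ Z ^ 3 := by gcongr
          calc m₂ ≤ 1000 * P * (1 / 10) ^ 3 := by linarith
            _ ≤ 1000 * P * Z ^ 3 := by gcongr
        rw [e2]
        calc _ ≤ 2 * P ^ 2 * (1000 * P) :=
              mul_le_mul (hdec b) e3 (by positivity) (by positivity)
          _ = C := by rw [hC]; ring
      have e2 : κ ≤ 1 / (2 * C) := min_le_right _ _
      have e3 : C / z ≤ 1 / 2 := by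
        rw [div_le_iff₀ hz0]; linarith
      have e4 : (sectionTransform j D b / Z) ^ 2 ≤ C / z := by rwa [le_div_iff₀ hz0]
      calc (sectionTransform j D b / Z) ^ 2 * (1 + κ * z)
          = (sectionTransform j D b / Z) ^ 2
            + κ * ((sectionTransform j D b / Z) ^ 2 * z) := by ring
        _ ≤ 1 / 2 + 1 / (2 * C) * C := add_le_add (e4.trans e3)
            (mul_le_mul e2 e1 (by positivity) (by positivity))
        _ = 1 := by field_simp; norm_num

/-! ### The section integral of an ellipsoid -/

/-- The constant `∫ (1 + x²) ^ (-d / 2) dx`. -/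
noncomputable def ellipsoidConst (d : ℕ) : ENNReal :=
  ∫⁻ x : ℝ, ENNReal.ofReal ((√(1 + x ^ 2))⁻¹ ^ d)

theorem lintegral_inv_sqrt_pow (d : ℕ) {q : ℝ} (hq : 0 < q) :
    ∫⁻ x : ℝ, ENNReal.ofReal ((√(1 + x ^ 2 * q))⁻¹ ^ d)
      = ENNReal.ofReal (√q)⁻¹ * ellipsoidConst d := by
  rw [ellipsoidConst, ← lintegral_comp_const_mul _ (Real.sqrt_pos.2 hq)]
  simp_rw [mul_pow, Real.sq_sqrt hq.le, mul_comm q]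

/-- The profile `(1 + q a²) ^ (-1/2)` of an ellipsoid is mapped to that of an ellipsoid. -/
theorem lintegral_ellipsoid {j : ℕ} (hj : j ≠ 0) (c : ℝ) {q : ℝ} (hq : 0 < q) :
    ∫⁻ a : ℝ, ENNReal.ofReal ((√(1 + q * a ^ 2))⁻¹ ^ (j + 3)) *
        ENNReal.ofReal (√(1 - a ^ 2 * c ^ 2) ^ j)
      = ENNReal.ofReal (√(c ^ 2 + q))⁻¹ * ellipsoidConst (j + 3) := by
  rw [← lintegral_inv_sqrt_pow _ (by positivity), ← lintegral_slope_subst _ _ hj]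
  refine lintegral_congr fun x => ?_
  rw [← ENNReal.ofReal_mul (by positivity), ← mul_pow, ← mul_inv,
    ← Real.sqrt_mul (by positivity), div_pow, Real.sq_sqrt (by positivity)]
  congr 5
  field_simp
  ring

theorem lintegral_sqrt_one_sub_pow {j : ℕ} (hj : j ≠ 0) {q : ℝ} (hq : 0 < q) :
    ∫⁻ a : ℝ, ENNReal.ofReal (√(1 - a ^ 2 * q) ^ j)
      = ENNReal.ofReal (√q)⁻¹ * ellipsoidConst (j + 3) := by
  have h := lintegral_slope_subst (fun _ => 1) (√q) hj
  simp only [one_mul, Real.sq_sqrt hq.le] at h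
  rw [← h, lintegral_inv_sqrt_pow _ hq]

theorem ellipsoidConst_le_pi {d : ℕ} (hd : 2 ≤ d) : ellipsoidConst d ≤ ENNReal.ofReal Real.pi := by
  rw [← integral_univ_inv_one_add_sq,
    ofReal_integral_eq_lintegral_ofReal integrable_inv_one_add_sq
      (Filter.Eventually.of_forall fun x => by positivity)]
  refine lintegral_mono fun x => ENNReal.ofReal_le_ofReal ?_
  have h1 : (√(1 + x ^ 2))⁻¹ ≤ 1 :=
    inv_le_one_of_one_le₀ (Real.one_le_sqrt.2 (by nlinarith [sq_nonneg x]))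
  calc (√(1 + x ^ 2))⁻¹ ^ d ≤ (√(1 + x ^ 2))⁻¹ ^ 2 :=
        pow_le_pow_of_le_one (by positivity) h1 hd
    _ = (1 + x ^ 2)⁻¹ := by rw [inv_pow, Real.sq_sqrt (by positivity)]

theorem ellipsoidConst_ge {d : ℕ} (hd : 0 < d) :
    ENNReal.ofReal (1 / (3 * d)) ≤ ellipsoidConst d := by
  have hd' : (0 : ℝ) < d := by exact_mod_cast hd
  have h1 : ∀ x ∈ Set.Icc (0 : ℝ) (1 / d),
      ENNReal.ofReal (1 / 3) ≤ ENNReal.ofReal ((√(1 + x ^ 2))⁻¹ ^ d) := by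
    intro x hx
    have hd1 : (1 : ℝ) ≤ d := by exact_mod_cast hd
    have hx1 : x ≤ 1 := hx.2.trans (by rw [div_le_one hd']; exact hd1)
    apply ENNReal.ofReal_le_ofReal
    rw [inv_pow, ← one_div]
    refine one_div_le_one_div_of_le (by positivity) ?_
    calc √(1 + x ^ 2) ^ d ≤ Real.exp x ^ d := by
          gcongr
          refine (Real.sqrt_le_left (by positivity)).2 ?_
          nlinarith [Real.add_one_le_exp x, hx.1, Real.exp_pos x]
      _ = Real.exp (d * x) := (Real.exp_nat_mul x d).symm
      _ ≤ Real.exp 1 := by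
          gcongr
          have := hx.2
          rw [le_div_iff₀ hd'] at this
          linarith
      _ ≤ 3 := by linarith [Real.exp_one_lt_d9]
  calc ENNReal.ofReal (1 / (3 * d))
      = ENNReal.ofReal (1 / 3) * volume (Set.Icc (0 : ℝ) (1 / d)) := by
        rw [Real.volume_Icc, ← ENNReal.ofReal_mul (by norm_num)]
        congr 1
        field_simp
        ring
    _ ≤ ∫⁻ x in Set.Icc (0 : ℝ) (1 / d), ENNReal.ofReal ((√(1 + x ^ 2))⁻¹ ^ d) := by
        rw [← setLIntegral_const]
        exact setLIntegral_mono (by fun_prop) h1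
    _ ≤ ellipsoidConst d := setLIntegral_le_lintegral _ _

theorem inv_sqrt_le_mul_inv_sqrt {x y s : ℝ} (hx : 0 < x) (hy : 0 < y) (hs : 0 < s)
    (h : y ≤ s ^ 2 * x) : (√x)⁻¹ ≤ s * (√y)⁻¹ := by
  have h1 : √y ≤ s * √x := by
    rw [Real.sqrt_le_left (by positivity), mul_pow, Real.sq_sqrt hx.le]
    exact h
  have := Real.sqrt_pos.2 hx
  have := Real.sqrt_pos.2 hy
  rw [← div_eq_mul_inv, le_div_iff₀ ‹0 < √y›, inv_mul_le_iff₀ ‹0 < √x›]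
  linarith

/-! ### Section integrals of nearly ellipsoidal profiles -/

namespace NearEllipsoidProfile

variable {j : ℕ} {δ η κ v : ℝ} {w : ℝ → ℝ}

/-- The lower bound has no error term. With `d = j + 3`, the power `w ^ d` dominates
`(1 - d v b²)₊ ^ (j / 2)` by Bernoulli's inequality, and since `(1 - x) (1 - y) ≥ 1 - x - y` for
`x, y ≥ 0`, what remains is the exactly computable integral of
`(1 - (c² + d v) b²)₊ ^ (j / 2)`. -/
theorem le_lintegral (h : NearEllipsoidProfile j δ η κ v w) (hj : j ≠ 0) (hv : 0 < v) (c : ℝ) :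
    ENNReal.ofReal (√(c ^ 2 + (j + 3 : ℕ) * v))⁻¹ * ellipsoidConst (j + 3)
      ≤ ∫⁻ b, ENNReal.ofReal (w b ^ (j + 3) * √(1 - b ^ 2 * c ^ 2) ^ j) := by
  rw [← lintegral_sqrt_one_sub_pow hj (by positivity)]
  refine lintegral_mono fun b => ENNReal.ofReal_le_ofReal ?_
  have hw := h.nonneg b
  rcases le_or_gt (1 - b ^ 2 * (c ^ 2 + (j + 3 : ℕ) * v)) 0 with hb | hb
  · rw [Real.sqrt_eq_zero_of_nonpos hb, zero_pow hj]
    positivity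
  · have hx : 0 ≤ v * b ^ 2 := by positivity
    have hy : 0 ≤ b ^ 2 * c ^ 2 := by positivity
    have hdx : 0 ≤ ((j + 3 : ℕ) : ℝ) * (v * b ^ 2) := by positivity
    have hdx1 : ((j + 3 : ℕ) : ℝ) * (v * b ^ 2) ≤ 1 := by nlinarith
    have h1 : √(1 - b ^ 2 * (c ^ 2 + (j + 3 : ℕ) * v))
        ≤ √(1 - (j + 3 : ℕ) * (v * b ^ 2)) * √(1 - b ^ 2 * c ^ 2) := by
      rw [← Real.sqrt_mul (by linarith)]
      apply Real.sqrt_le_sqrt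
      nlinarith [mul_nonneg hdx hy]
    have h2 := sqrt_pow_le_pow hx (j := j) (d := j + 3) (Nat.pos_of_ne_zero hj) (by omega) hdx1
    have h3 : 0 ≤ 1 - j / 2 * (v * b ^ 2) := by
      push_cast at hdx1
      have : 0 ≤ (j : ℝ) * (v * b ^ 2) := by positivity
      nlinarith
    calc _ ≤ (√(1 - (j + 3 : ℕ) * (v * b ^ 2)) * √(1 - b ^ 2 * c ^ 2)) ^ j := by gcongr
      _ = √(1 - (j + 3 : ℕ) * (v * b ^ 2)) ^ j * √(1 - b ^ 2 * c ^ 2) ^ j := mul_pow _ _ _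
      _ ≤ (1 - j / 2 * (v * b ^ 2)) ^ (j + 3) * √(1 - b ^ 2 * c ^ 2) ^ j := by gcongr
      _ ≤ _ := by
        gcongr
        exact h.lower b

/-- The first term comes from slopes with `j v b² ≤ η`. The second one, from the remaining slopes,
is exponentially small in `j`. -/
theorem lintegral_le (h : NearEllipsoidProfile j δ η κ v w) (hj : 1 ≤ j) (hv : 0 < v)
    (hδ : δ < 1) (hκ : 0 < κ) (hη : 0 < η) (c : ℝ) :
    ∫⁻ b, ENNReal.ofReal (w b ^ (j + 3) * √(1 - b ^ 2 * c ^ 2) ^ j)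
      ≤ ENNReal.ofReal (√(c ^ 2 + (1 - δ) * (j * v)))⁻¹ * ellipsoidConst (j + 3)
        + ENNReal.ofReal ((√(1 + κ * η))⁻¹ ^ (j - 1)) *
          (ENNReal.ofReal (√(c ^ 2 + κ * (j * v)))⁻¹ * ellipsoidConst 4) := by
  have hj0 : (0 : ℝ) < j := by exact_mod_cast hj
  have hδ' : 0 < 1 - δ := by linarith
  have hle : ∀ {x s : ℝ}, 0 < x → 0 ≤ s → s ^ 2 * x ≤ 1 → s ≤ (√x)⁻¹ := by
    intro x s hx hs hsx
    rw [← Real.sqrt_inv]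
    apply Real.le_sqrt_of_sq_le
    rwa [← one_div, le_div_iff₀ hx]
  rw [← lintegral_ellipsoid (by omega) c (by positivity),
    ← lintegral_ellipsoid (j := 1) one_ne_zero c (by positivity),
    ← lintegral_const_mul' _ _ ENNReal.ofReal_ne_top, ← lintegral_add_left (by fun_prop)]
  refine lintegral_mono fun b => ?_
  have hw := h.nonneg b
  have hs1 : √(1 - b ^ 2 * c ^ 2) ^ j ≤ 1 := sqrt_one_sub_pow_le_one b c j
  rcases le_total (j * v * b ^ 2) η with hb | hb
  · refine le_trans ?_ le_self_add
    rw [← ENNReal.ofReal_mul (by positivity)]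
    apply ENNReal.ofReal_le_ofReal
    gcongr
    apply hle (by positivity) hw
    convert h.near b hb using 3
    ring
  · refine le_trans ?_ le_add_self
    rw [← ENNReal.ofReal_mul (by positivity), ← ENNReal.ofReal_mul (by positivity)]
    apply ENNReal.ofReal_le_ofReal
    have e1 : w b ≤ (√(1 + κ * (j * v) * b ^ 2))⁻¹ := by
      apply hle (by positivity) hw
      convert h.far b hb using 3
      ring
    have e2 : w b ≤ (√(1 + κ * η))⁻¹ := by
      refine e1.trans ?_
      have e3 : κ * η ≤ κ * (j * v) * b ^ 2 := by
        rw [mul_assoc]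
        exact mul_le_mul_of_nonneg_left hb hκ.le
      gcongr
    calc w b ^ (j + 3) * √(1 - b ^ 2 * c ^ 2) ^ j
        = w b ^ (j - 1) * (w b ^ 4 * √(1 - b ^ 2 * c ^ 2) ^ j) := by
          rw [← mul_assoc, ← pow_add]
          congr 2
          omega
      _ ≤ (√(1 + κ * η))⁻¹ ^ (j - 1) * ((√(1 + κ * (j * v) * b ^ 2))⁻¹ ^ 4
            * √(1 - b ^ 2 * c ^ 2) ^ 1) := by
          gcongr ?_ * (?_ * ?_)
          · gcongr
          · gcongr
          · refine pow_le_pow_of_le_one (Real.sqrt_nonneg _) ?_ hj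
            simpa using sqrt_one_sub_pow_le_one b c 1

end NearEllipsoidProfile

/-- For a tame density, the second transform is that of an ellipsoid up to a factor `1 + ε`. -/
theorem TameDensity.exists_ellipsoid_bounds (B : ℝ) {ε : ℝ} (hε : 0 < ε) :
    ∃ j₀ : ℕ, ∀ j : ℕ, j₀ ≤ j → ∀ D : ℝ → ℝ, TameDensity B D → ∃ q > 0, ∀ c : ℝ,
      ENNReal.ofReal (√(c ^ 2 + q))⁻¹ * ellipsoidConst (j + 3)
        ≤ ∫⁻ b, ENNReal.ofReal ((sectionTransform j D b / sectionTransform j D 0) ^ (j + 3)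
            * √(1 - b ^ 2 * c ^ 2) ^ j) ∧
      ∫⁻ b, ENNReal.ofReal ((sectionTransform j D b / sectionTransform j D 0) ^ (j + 3)
            * √(1 - b ^ 2 * c ^ 2) ^ j)
        ≤ ENNReal.ofReal ((1 + ε) * (√(c ^ 2 + q))⁻¹) * ellipsoidConst (j + 3) := by
  -- `δ` is chosen so that `(1 + ε / 2)² (1 - δ) = 1 + ε / 2`
  set δ : ℝ := 1 - (1 + ε / 2)⁻¹ with hδ
  have hδ0 : 0 < δ := by
    rw [hδ, sub_pos]
    exact inv_lt_one_of_one_lt₀ (by linarith)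
  have hδ1 : δ < 1 := by
    rw [hδ, sub_lt_self_iff]
    positivity
  obtain ⟨η, hη, κ, hκ, H⟩ := exists_nearEllipsoidProfile B hδ0 hδ1
  set r : ℝ := (√(1 + κ * η))⁻¹ with hr
  have hr0 : 0 < r := by positivity
  have hr1 : r < 1 := by
    apply inv_lt_one_of_one_lt₀
    rw [Real.lt_sqrt (by norm_num)]
    nlinarith [mul_pos hκ hη]
  -- `S` is such that `c² + (j + 3) v ≤ S² (c² + κ j v)`
  set S : ℝ := 1 + 4 / κ with hS
  have hS0 : 0 < S := by positivity
  have hlim : Filter.Tendsto (fun j : ℕ => r ^ (j - 1) * (Real.pi * S * (3 * ((j + 3 : ℕ) : ℝ))))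
      Filter.atTop (nhds 0) := by
    rw [← Filter.tendsto_add_atTop_iff_nat 1]
    have e1 := tendsto_pow_const_mul_const_pow_of_abs_lt_one 1 (r := r)
      (by rwa [abs_of_pos hr0])
    have e2 := tendsto_pow_const_mul_const_pow_of_abs_lt_one 0 (r := r)
      (by rwa [abs_of_pos hr0])
    have e3 := (e1.const_mul (Real.pi * S * 3)).add (e2.const_mul (Real.pi * S * 3 * 4))
    simp only [mul_zero, add_zero] at e3
    refine e3.congr fun j => ?_
    push_cast
    ring
  obtain ⟨j₁, hj₁⟩ := Filter.eventually_atTop.1 (hlim.eventually_le_const (half_pos hε))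
  obtain ⟨j₂, hj₂⟩ := exists_nat_ge (6 / ε)
  refine ⟨max 2 (max j₁ j₂), fun j hj D hD => ?_⟩
  have hj2 : 2 ≤ j := (le_max_left _ _).trans hj
  have hjj₁ := hj₁ j (((le_max_left _ _).trans (le_max_right _ _)).trans hj)
  have hjj₂ : 6 / ε ≤ j := hj₂.trans (by
    exact_mod_cast ((le_max_right _ _).trans (le_max_right _ _)).trans hj)
  have hj0 : (2 : ℝ) ≤ j := by exact_mod_cast hj2
  obtain ⟨v, hv, hw⟩ := H j D hj2 hD
  refine ⟨(j + 3 : ℕ) * v, by positivity, fun c => ⟨hw.le_lintegral (by omega) hv c, ?_⟩⟩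
  refine (hw.lintegral_le (by omega) hv hδ1 hκ hη c).trans ?_
  have hδ' : 1 - δ = (1 + ε / 2)⁻¹ := by rw [hδ]; ring
  set Q : ℝ := c ^ 2 + (j + 3 : ℕ) * v with hQ
  have hQ0 : 0 < Q := by positivity
  have hjv : 0 < j * v := by positivity
  have b1 : (√(c ^ 2 + (1 - δ) * (j * v)))⁻¹ ≤ (1 + ε / 2) * (√Q)⁻¹ := by
    apply inv_sqrt_le_mul_inv_sqrt _ hQ0 (by positivity)
    · rw [hδ', mul_add]
      have e1 : (1 + ε / 2) ^ 2 * ((1 + ε / 2)⁻¹ * (j * v)) = (1 + ε / 2) * (j * v) := by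
        field_simp
      have e2 : (3 : ℝ) ≤ ε / 2 * j := by
        rw [div_le_iff₀ hε] at hjj₂
        linarith
      have e3 : c ^ 2 ≤ (1 + ε / 2) ^ 2 * c ^ 2 :=
        le_mul_of_one_le_left (sq_nonneg c) (by nlinarith)
      have e4 : 3 * v ≤ ε / 2 * j * v := by gcongr
      rw [e1, hQ]
      push_cast
      nlinarith
    · rw [hδ']
      positivity
  have b2 : (√(c ^ 2 + κ * (j * v)))⁻¹ ≤ S * (√Q)⁻¹ := by
    apply inv_sqrt_le_mul_inv_sqrt (by positivity) hQ0 hS0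
    have hS1 : 1 ≤ S := by rw [hS]; linarith [div_pos (by norm_num : (0 : ℝ) < 4) hκ]
    have hSS : S ≤ S ^ 2 := by nlinarith
    have e1 : 4 ≤ S * κ := by
      rw [hS, add_mul, div_mul_cancel₀ _ hκ.ne']
      linarith
    have e2 : c ^ 2 ≤ S ^ 2 * c ^ 2 := le_mul_of_one_le_left (sq_nonneg c) (by linarith)
    have e3 : 4 * (j * v) ≤ S ^ 2 * (κ * (j * v)) := by
      calc 4 * (j * v) ≤ S * κ * (j * v) := by gcongr
        _ ≤ S ^ 2 * κ * (j * v) := by gcongr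
        _ = _ := by ring
    rw [hQ]
    push_cast
    nlinarith
  have hJ := ellipsoidConst_ge (d := j + 3) (by omega)
  have b3 : ENNReal.ofReal (r ^ (j - 1)) *
      (ENNReal.ofReal (√(c ^ 2 + κ * (j * v)))⁻¹ * ellipsoidConst 4)
      ≤ ENNReal.ofReal (ε / 2 * (√Q)⁻¹) * ellipsoidConst (j + 3) := by
    calc _ ≤ ENNReal.ofReal (r ^ (j - 1)) *
          (ENNReal.ofReal (S * (√Q)⁻¹) * ENNReal.ofReal Real.pi) := by
          gcongr
          exact ellipsoidConst_le_pi (by norm_num)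
      _ = ENNReal.ofReal (r ^ (j - 1) * (Real.pi * S * (3 * ((j + 3 : ℕ) : ℝ))) * (√Q)⁻¹) *
          ENNReal.ofReal (1 / (3 * ((j + 3 : ℕ) : ℝ))) := by
          rw [← ENNReal.ofReal_mul (by positivity), ← ENNReal.ofReal_mul (by positivity),
            ← ENNReal.ofReal_mul (by positivity)]
          congr 1
          field_simp
      _ ≤ _ := by gcongr
  calc _ ≤ ENNReal.ofReal ((1 + ε / 2) * (√Q)⁻¹) * ellipsoidConst (j + 3)
        + ENNReal.ofReal (ε / 2 * (√Q)⁻¹) * ellipsoidConst (j + 3) := by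
        gcongr
    _ = _ := by
        rw [← add_mul, ← ENNReal.ofReal_add (by positivity) (by positivity)]
        congr 2
        ring

/-! ### Densities that are powers of convex functions -/

/-- For an even convex function `h` with `h 0 = 1` and `h 1 = 1 + 1 / d`, the values on `[-1, 1]`
are at most `1 + 1 / d`, and `h a ≥ 1 + |a| / d` beyond, so `h ^ (-d)` is tame. The constant is
`46656 = 36 ^ 3`, from `(1 + |a| / d) ^ d ≥ (1 + |a| / 6) ^ 6` and
`36 (1 + |a| / 6) ^ 2 ≥ 1 + a²`. -/
theorem tameDensity_inv_pow {h : ℝ → ℝ} {d : ℕ} (hd : 6 ≤ d) (hc : ConvexOn ℝ Set.univ h)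
    (hm : Measurable h) (heven : ∀ a, h (-a) = h a) (h0 : h 0 = 1) (h1 : h 1 = 1 + 1 / d) :
    TameDensity 46656 fun a => (h a)⁻¹ ^ d := by
  have hd0 : (0 : ℝ) < d := by
    have : 0 < d := by omega
    exact_mod_cast this
  have hd6 : (6 : ℝ) ≤ d := by exact_mod_cast hd
  have hconv : ∀ x y p r : ℝ, 0 ≤ p → 0 ≤ r → p + r = 1 →
      h (p * x + r * y) ≤ p * h x + r * h y :=
    fun x y p r hp hr hpr => hc.2 (Set.mem_univ x) (Set.mem_univ y) hp hr hpr
  have hge : ∀ a, 1 ≤ h a := by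
    intro a
    have := hconv a (-a) (1 / 2) (1 / 2) (by norm_num) (by norm_num) (by norm_num)
    rw [heven] at this
    rw [show (1 / 2 : ℝ) * a + 1 / 2 * -a = 0 by ring, h0] at this
    linarith
  have habs : ∀ a, h |a| = h a := by
    intro a
    rcases abs_choice a with ha | ha <;> rw [ha]
    exact heven a
  have hpos : ∀ a, 0 < h a := fun a => one_pos.trans_le (hge a)
  refine ⟨by fun_prop, fun a => by have := hpos a; positivity, fun a => ?_, fun a ha => ?_⟩
  · rcases le_total |a| 1 with ha | ha
    · have e1 : (h a)⁻¹ ^ d ≤ 1 :=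
        pow_le_one₀ (inv_nonneg.2 (hpos a).le) (inv_le_one_of_one_le₀ (hge a))
      have e2 : a ^ 2 ≤ 1 := by rw [← sq_abs]; exact pow_le_one₀ (abs_nonneg a) ha
      have e3 : (1 / 2 : ℝ) ≤ (1 + a ^ 2)⁻¹ := by
        rw [← one_div]
        exact one_div_le_one_div_of_le (by positivity) (by linarith)
      calc (h a)⁻¹ ^ d ≤ 46656 * (1 / 2 : ℝ) ^ 3 := e1.trans (by norm_num)
        _ ≤ _ := by gcongr
    · have ha0 : 0 < |a| := by linarith
      have e1 : 1 + |a| / d ≤ h a := by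
        have := hconv 0 |a| (1 - |a|⁻¹) |a|⁻¹
          (sub_nonneg.2 (inv_le_one_of_one_le₀ ha)) (by positivity) (by ring)
        simp only [mul_zero, zero_add, inv_mul_cancel₀ ha0.ne', h0, h1, habs,
          mul_one] at this
        have e2 : |a| * (1 + 1 / d) ≤ |a| * (1 - |a|⁻¹ + |a|⁻¹ * h a) := by gcongr
        have e3 : |a| * (1 - |a|⁻¹ + |a|⁻¹ * h a) = |a| - 1 + h a := by
          field_simp
        rw [e3] at e2
        have e4 : |a| * (1 + 1 / d) = |a| + |a| / d := by ring
        linarith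
      have e2 : 1 + |a| / 6 ≤ (1 + |a| / d) ^ ((d : ℝ) / 6) := by
        have := one_add_mul_self_le_rpow_one_add (s := |a| / d) (p := d / 6)
          (by linarith [div_nonneg ha0.le hd0.le]) (by linarith)
        convert this using 2
        field_simp
      have e3 : (1 + |a| / 6) ^ 6 ≤ (h a) ^ d := by
        calc (1 + |a| / 6) ^ 6 ≤ ((1 + |a| / d) ^ ((d : ℝ) / 6)) ^ 6 := by gcongr
          _ = (1 + |a| / d) ^ d := by
            rw [← Real.rpow_natCast, ← Real.rpow_mul (by positivity), ← Real.rpow_natCast]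
            congr 1
            push_cast
            ring
          _ ≤ _ := by gcongr
      have e4 : (1 + a ^ 2) ^ 3 ≤ 46656 * (h a) ^ d := by
        have e5 : 1 + a ^ 2 ≤ 36 * (1 + |a| / 6) ^ 2 := by
          rw [← sq_abs]
          nlinarith
        calc (1 + a ^ 2) ^ 3 ≤ (36 * (1 + |a| / 6) ^ 2) ^ 3 := by gcongr
          _ = 46656 * (1 + |a| / 6) ^ 6 := by ring
          _ ≤ _ := by gcongr
      have := hpos a
      rw [inv_pow, inv_pow, inv_le_iff_one_le_mul₀ (by positivity)]
      rw [mul_right_comm, ← div_eq_mul_inv, le_div_iff₀ (by positivity)]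
      linarith
  · have e1 : h a ≤ 1 + 1 / d := by
      have := hconv 0 1 (1 - |a|) |a| (by linarith) (abs_nonneg a) (by ring)
      simp only [mul_zero, zero_add, mul_one, h0, h1, habs] at this
      have e2 : |a| * (1 / d) ≤ 1 * (1 / d) := by gcongr
      linarith
    have e2 : (h a) ^ d ≤ Real.exp 1 := by
      calc (h a) ^ d ≤ (Real.exp (1 / d)) ^ d := by
            gcongr
            · exact (hpos a).le
            · linarith [Real.add_one_le_exp (1 / (d : ℝ))]
        _ = Real.exp 1 := by
            rw [← Real.exp_nat_mul]
            congr 1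
            field_simp
    rw [Real.exp_neg, inv_pow]
    exact inv_anti₀ (pow_pos (hpos a) d) e2

theorem sectionTransform_scale (j : ℕ) (D : ℝ → ℝ) (H : ℝ) {A : ℝ} (hA : 0 < A) (b : ℝ) :
    sectionTransform j (fun a => H * D (A⁻¹ * a)) b = H * A * sectionTransform j D (A * b) := by
  have h := Measure.integral_comp_mul_left (fun a => D a * √(1 - a ^ 2 * (A * b) ^ 2) ^ j) A⁻¹
  rw [inv_inv, abs_of_pos hA, smul_eq_mul] at h
  rw [sectionTransform, sectionTransform, mul_assoc, ← h, ← integral_const_mul]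
  congr 1
  ext a
  rw [show (A⁻¹ * a) ^ 2 * (A * b) ^ 2 = a ^ 2 * b ^ 2 by field_simp]
  ring

/-- The second transform of `g ^ (-d)`, for an even convex `g`, is that of an ellipsoid up to a
factor `1 + ε` once `d` is large. Rescaling the slope by the point where `g` exceeds `g 0` by the
factor `1 + 1 / d` makes the density tame. -/
theorem exists_ellipsoid_bounds_of_convex {ε : ℝ} (hε : 0 < ε) :
    ∃ j₀ : ℕ, ∀ j : ℕ, j₀ ≤ j → ∀ g : ℝ → ℝ, ConvexOn ℝ Set.univ g → Continuous g →
      (∀ a, g (-a) = g a) → (∀ a, 0 < g a) → (∃ k > 0, ∀ a, k * a ≤ g a) →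
      ∀ Ψ : ℝ → ℝ, Ψ = sectionTransform j (fun a => (g a)⁻¹ ^ (j + 3)) →
      Integrable (fun a => (g a)⁻¹ ^ (j + 3)) ∧ 0 < Ψ 0 ∧ ∃ q > 0, ∀ c : ℝ,
      ENNReal.ofReal (Ψ 0 ^ (j + 3) * (√(c ^ 2 + q))⁻¹) * ellipsoidConst (j + 3)
        ≤ ∫⁻ b, ENNReal.ofReal (Ψ b ^ (j + 3) * √(1 - b ^ 2 * c ^ 2) ^ j) ∧
      ∫⁻ b, ENNReal.ofReal (Ψ b ^ (j + 3) * √(1 - b ^ 2 * c ^ 2) ^ j)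
        ≤ ENNReal.ofReal ((1 + ε) * (Ψ 0 ^ (j + 3) * (√(c ^ 2 + q))⁻¹))
          * ellipsoidConst (j + 3) := by
  obtain ⟨j₀, hj₀⟩ := TameDensity.exists_ellipsoid_bounds 46656 hε
  refine ⟨max 3 j₀, fun j hj g hc hg heven hpos ⟨k, hk, hgk⟩ Ψ hΨ => ?_⟩
  set d := j + 3 with hd
  have hj3 : 3 ≤ j := (le_max_left _ _).trans hj
  have hd0 : (0 : ℝ) < d := by positivity
  have hg0 := hpos 0
  obtain ⟨A, hA, hgA⟩ : ∃ A > 0, g A = g 0 * (1 + 1 / d) := by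
    set t := g 0 * (1 + 1 / d) with ht
    have ht0 : 0 < t := by positivity
    have hgt : g 0 < t := by
      rw [ht]
      exact lt_mul_of_one_lt_right hg0 (by linarith [one_div_pos.2 hd0])
    have hmem : t ∈ Set.Icc (g 0) (g (t / k)) :=
      ⟨hgt.le, by have := hgk (t / k); rwa [mul_div_cancel₀ _ hk.ne'] at this⟩
    obtain ⟨A, hA, hAt⟩ := intermediate_value_Icc (div_nonneg ht0.le hk.le) hg.continuousOn hmem
    refine ⟨A, lt_of_le_of_ne hA.1 ?_, hAt⟩
    rintro rfl
    exact hgt.ne hAt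
  set h : ℝ → ℝ := fun a => (g 0)⁻¹ * g (A * a) with hh
  have htame : TameDensity 46656 fun a => (h a)⁻¹ ^ d := by
    apply tameDensity_inv_pow (by omega)
    · have e1 : ConvexOn ℝ Set.univ fun a => g (A * a) := by
        refine ⟨convex_univ, fun x _ y _ a b ha hb hab => ?_⟩
        have := hc.2 (Set.mem_univ (A * x)) (Set.mem_univ (A * y)) ha hb hab
        convert this using 2
        simp only [smul_eq_mul]
        ring
      simpa [hh] using e1.smul (inv_nonneg.2 hg0.le)
    · fun_prop
    · intro a
      simp [hh, heven]
    · simp [hh, hg0.ne']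
    · simp only [hh, mul_one, hgA]
      field_simp
  set D : ℝ → ℝ := fun a => (h a)⁻¹ ^ d with hD
  set H : ℝ := (g 0)⁻¹ ^ d with hH
  have hH0 : 0 < H := by positivity
  have hDg : (fun a => (g a)⁻¹ ^ d) = fun a => H * D (A⁻¹ * a) := by
    ext a
    simp only [hD, hH, hh, mul_inv_cancel_left₀ hA.ne']
    rw [← mul_pow]
    congr 1
    field_simp
  have hΨb : ∀ b, Ψ b = H * A * sectionTransform j D (A * b) := by
    intro b
    rw [hΨ, hDg, sectionTransform_scale _ _ _ hA]
  have hZ : 0 < sectionTransform j D 0 := by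
    rw [sectionTransform_zero]
    exact htame.integral_pos
  have hΨ0 : Ψ 0 = H * A * sectionTransform j D 0 := by rw [hΨb, mul_zero]
  have hΨ0p : 0 < Ψ 0 := by rw [hΨ0]; positivity
  refine ⟨?_, hΨ0p, ?_⟩
  · rw [hDg]
    exact (htame.integrable.comp_mul_left' (inv_ne_zero hA.ne')).const_mul H
  obtain ⟨q, hq, hqc⟩ := hj₀ j ((le_max_right _ _).trans hj) D htame
  refine ⟨A ^ 2 * q, by positivity, fun c => ?_⟩
  have key : ∫⁻ b, ENNReal.ofReal (Ψ b ^ d * √(1 - b ^ 2 * c ^ 2) ^ j)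
      = ENNReal.ofReal (Ψ 0 ^ d * A⁻¹) * ∫⁻ b, ENNReal.ofReal
        ((sectionTransform j D b / sectionTransform j D 0) ^ d * √(1 - b ^ 2 * (c / A) ^ 2) ^ j) := by
    rw [ENNReal.ofReal_mul (by positivity), mul_assoc, ← lintegral_comp_const_mul _ hA,
      ← lintegral_const_mul' _ _ ENNReal.ofReal_ne_top]
    refine lintegral_congr fun b => ?_
    have e1 : Ψ b = Ψ 0 * (sectionTransform j D (A * b) / sectionTransform j D 0) := by
      rw [hΨ0, hΨb b]
      field_simp
    rw [← ENNReal.ofReal_mul (by positivity), ← mul_assoc, e1, mul_pow (Ψ 0),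
      show (A * b) ^ 2 * (c / A) ^ 2 = b ^ 2 * c ^ 2 by field_simp]
  have hs : (√((c / A) ^ 2 + q))⁻¹ = A * (√(c ^ 2 + A ^ 2 * q))⁻¹ := by
    have : c ^ 2 + A ^ 2 * q = A ^ 2 * ((c / A) ^ 2 + q) := by field_simp
    rw [this, Real.sqrt_mul (by positivity), Real.sqrt_sq hA.le]
    field_simp
  obtain ⟨h1, h2⟩ := hqc (c / A)
  rw [hs] at h1 h2
  rw [key]
  constructor
  · refine le_trans (le_of_eq ?_) (mul_le_mul_right h1 _)
    rw [← mul_assoc, ← ENNReal.ofReal_mul (by positivity)]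
    congr 2
    field_simp
  · refine (mul_le_mul_right h2 _).trans (le_of_eq ?_)
    rw [← mul_assoc, ← ENNReal.ofReal_mul (by positivity)]
    congr 2
    field_simp

/-! ### Sections of bodies of revolution -/

theorem lintegral_fun_norm {E : Type*} [NormedAddCommGroup E] [NormedSpace ℝ E]
    [FiniteDimensional ℝ E] [Nontrivial E] [MeasurableSpace E] [BorelSpace E] (μ : Measure E)
    [μ.IsAddHaarMeasure] {f : ℝ → ENNReal} (hf : Measurable f) :
    ∫⁻ x, f ‖x‖ ∂μ = Module.finrank ℝ E * μ (Metric.ball 0 1) *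
      ∫⁻ y in Set.Ioi (0 : ℝ), f y * ENNReal.ofReal (y ^ (Module.finrank ℝ E - 1)) := by
  calc
    ∫⁻ x, f ‖x‖ ∂μ = ∫⁻ x : ({(0)}ᶜ : Set E), f ‖x.1‖ ∂(μ.comap (↑)) := by
      rw [lintegral_subtype_comap (measurableSet_singleton _).compl fun x ↦ f ‖x‖,
        restrict_compl_singleton]
    _ = ∫⁻ x, f x.2 ∂μ.toSphere.prod (.volumeIoiPow (Module.finrank ℝ E - 1)) := by
      rw [← μ.measurePreserving_homeomorphUnitSphereProd.lintegral_comp (by fun_prop)]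
      simp
    _ = μ.toSphere Set.univ *
        ∫⁻ x : Set.Ioi (0 : ℝ), f x ∂.volumeIoiPow (Module.finrank ℝ E - 1) := by
      rw [lintegral_prod _ (by fun_prop)]
      simp [mul_comm]
    _ = _ := by
      rw [μ.toSphere_apply_univ, Measure.volumeIoiPow,
        lintegral_withDensity_eq_lintegral_mul _ (by fun_prop) (by fun_prop)]
      simp only [Pi.mul_apply]
      rw [lintegral_subtype_comap measurableSet_Ioi fun a : ℝ ↦
        ENNReal.ofReal (a ^ (Module.finrank ℝ E - 1)) * f a]
      simp_rw [mul_comm (f _)]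

/-- The distance of `x` to the line spanned by the unit vector `e`. -/
noncomputable def axialDist {E : Type*} [NormedAddCommGroup E] [InnerProductSpace ℝ E]
    (e x : E) : ℝ :=
  √(‖x‖ ^ 2 - (inner ℝ e x) ^ 2)

theorem axialDist_nonneg {E : Type*} [NormedAddCommGroup E] [InnerProductSpace ℝ E] (e x : E) :
    0 ≤ axialDist e x :=
  Real.sqrt_nonneg _

theorem axialDist_sq {E : Type*} [NormedAddCommGroup E] [InnerProductSpace ℝ E] {e : E}
    (he : ‖e‖ = 1) (x : E) : axialDist e x ^ 2 = ‖x‖ ^ 2 - (inner ℝ e x) ^ 2 := by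
  apply Real.sq_sqrt
  have := abs_real_inner_le_norm e x
  rw [he, one_mul] at this
  rw [sub_nonneg, ← sq_abs]
  gcongr

/-- Off the axis `ℝ e`, the set `S` consists of the points whose distance to the axis is at most
`Φ` of their slope, the quotient of the coordinate along the axis by the distance to it. -/
def HasSlopeProfile {E : Type*} [NormedAddCommGroup E] [InnerProductSpace ℝ E]
    (e : E) (S : Set E) (Φ : ℝ → ℝ) : Prop :=
  ∀ x, 0 < axialDist e x → (x ∈ S ↔ axialDist e x ≤ Φ (inner ℝ e x / axialDist e x))

/-- The constant `m |B₂ᵐ| / (m + 1)` of the section formula in dimension `m + 2`. -/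
noncomputable def sectionConst (m : ℕ) : ℝ :=
  m * (volume (Metric.ball (0 : EuclideanSpace ℝ (Fin m)) 1)).toReal / (m + 1)

theorem sectionConst_pos {m : ℕ} (hm : 0 < m) : 0 < sectionConst m := by
  have h1 : (0 : ℝ) < m := by exact_mod_cast hm
  have h2 := ENNReal.toReal_pos
    (Metric.measure_ball_pos volume (0 : EuclideanSpace ℝ (Fin m)) one_pos).ne'
    measure_ball_lt_top.ne
  unfold sectionConst
  positivity

/-- The Lebesgue measure in cylindrical coordinates of a set described by its slope `x = τ / ‖z‖`:
after the substitution `τ = x ‖z‖`, the layer cake formula gives the integral of the power of the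
profile. -/
theorem volume_slope_region {m : ℕ} (hm : 0 < m) {c s : ℝ} {Φ : ℝ → ℝ} (hΦ : Measurable Φ)
    (hΦ0 : ∀ x, 0 ≤ Φ x) :
    volume {p : ℝ × EuclideanSpace ℝ (Fin m) |
        √(p.1 ^ 2 * c ^ 2 + ‖p.2‖ ^ 2) ≤ Φ (p.1 * s / √(p.1 ^ 2 * c ^ 2 + ‖p.2‖ ^ 2))}
      = ENNReal.ofReal (sectionConst m) * ∫⁻ x, ENNReal.ofReal
        ((Φ (x * s / √(1 + x ^ 2 * c ^ 2)) / √(1 + x ^ 2 * c ^ 2)) ^ (m + 1)) := by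
  have : Nonempty (Fin m) := ⟨⟨0, hm⟩⟩
  set W : Set (ℝ × ℝ) := {p | √(p.1 ^ 2 * c ^ 2 + p.2 ^ 2)
    ≤ Φ (p.1 * s / √(p.1 ^ 2 * c ^ 2 + p.2 ^ 2))} with hW
  have hWm : MeasurableSet W := measurableSet_le (by fun_prop) (by fun_prop)
  have hfm : Measurable fun ρ : ℝ => volume ((fun τ : ℝ => (τ, ρ)) ⁻¹' W) :=
    measurable_measure_prodMk_right hWm
  have hAm : MeasurableSet {p : ℝ × EuclideanSpace ℝ (Fin m) |
        √(p.1 ^ 2 * c ^ 2 + ‖p.2‖ ^ 2) ≤ Φ (p.1 * s / √(p.1 ^ 2 * c ^ 2 + ‖p.2‖ ^ 2))} :=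
    measurableSet_le (by fun_prop) (by fun_prop)
  set M : ℝ → ℝ := fun x => Φ (x * s / √(1 + x ^ 2 * c ^ 2)) / √(1 + x ^ 2 * c ^ 2) with hM
  have hslice : ∀ ρ : ℝ, 0 < ρ → volume ((fun τ : ℝ => (τ, ρ)) ⁻¹' W)
      = ENNReal.ofReal ρ * volume {x | ρ ≤ M x} := by
    intro ρ hρ
    have h1 : {x | ρ ≤ M x} = (fun x => ρ * x) ⁻¹' ((fun τ : ℝ => (τ, ρ)) ⁻¹' W) := by
      ext x
      have e1 : √((ρ * x) ^ 2 * c ^ 2 + ρ ^ 2) = ρ * √(1 + x ^ 2 * c ^ 2) := by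
        rw [show (ρ * x) ^ 2 * c ^ 2 + ρ ^ 2 = ρ ^ 2 * (1 + x ^ 2 * c ^ 2) by ring,
          Real.sqrt_mul (by positivity), Real.sqrt_sq hρ.le]
      have e2 : 0 < √(1 + x ^ 2 * c ^ 2) := Real.sqrt_pos.2 (by positivity)
      have e3 : ρ * x * s / (ρ * √(1 + x ^ 2 * c ^ 2)) = x * s / √(1 + x ^ 2 * c ^ 2) := by
        field_simp
      simp only [hM, hW, Set.mem_preimage, Set.mem_ofPred_eq, e1, e3]
      rw [le_div_iff₀ e2]
    rw [h1, Real.volume_preimage_mul_left hρ.ne', ← mul_assoc, ← ENNReal.ofReal_mul hρ.le,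
      abs_of_pos (inv_pos.2 hρ), mul_inv_cancel₀ hρ.ne', ENNReal.ofReal_one, one_mul]
  have hcake := lintegral_rpow_eq_lintegral_meas_le_mul volume (f := M) (p := (m + 1 : ℕ))
    (Filter.Eventually.of_forall fun x => div_nonneg (hΦ0 _) (Real.sqrt_nonneg _))
    (by fun_prop) (by positivity)
  simp only [Real.rpow_natCast] at hcake
  have hK : (m : ENNReal) * volume (Metric.ball (0 : EuclideanSpace ℝ (Fin m)) 1)
      = ENNReal.ofReal (sectionConst m) * ENNReal.ofReal ((m + 1 : ℕ) : ℝ) := by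
    rw [← ENNReal.ofReal_mul (sectionConst_pos hm).le, sectionConst]
    push_cast
    rw [div_mul_cancel₀ _ (by positivity), ENNReal.ofReal_mul (by positivity),
      ENNReal.ofReal_natCast, ENNReal.ofReal_toReal measure_ball_lt_top.ne]
  have hpre : ∀ z : EuclideanSpace ℝ (Fin m), ((fun x : ℝ => (x, z)) ⁻¹'
      {p : ℝ × EuclideanSpace ℝ (Fin m) |
        √(p.1 ^ 2 * c ^ 2 + ‖p.2‖ ^ 2) ≤ Φ (p.1 * s / √(p.1 ^ 2 * c ^ 2 + ‖p.2‖ ^ 2))})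
      = (fun τ : ℝ => (τ, ‖z‖)) ⁻¹' W := fun z => rfl
  rw [hcake, Measure.volume_eq_prod, Measure.prod_apply_symm hAm]
  simp_rw [hpre]
  rw [lintegral_fun_norm volume hfm, finrank_euclideanSpace_fin, hK, mul_assoc]
  congr 2
  refine setLIntegral_congr_fun measurableSet_Ioi fun ρ (hρ : 0 < ρ) => ?_
  rw [hslice ρ hρ, mul_right_comm, mul_comm, ← ENNReal.ofReal_mul hρ.le]
  congr 2
  rw [show ((m + 1 : ℕ) : ℝ) - 1 = m by push_cast; ring, Real.rpow_natCast, ← pow_succ']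
  congr 1
  omega

/-- In the plane of `e` and `v`, there is a unit vector `a` orthogonal to `v`. -/
theorem exists_unit_orthogonal {E : Type*} [NormedAddCommGroup E] [InnerProductSpace ℝ E]
    [FiniteDimensional ℝ E] (hE : 2 ≤ Module.finrank ℝ E) {e v : E} (he : ‖e‖ = 1)
    (hv : ‖v‖ = 1) : ∃ a : E, ‖a‖ = 1 ∧ inner ℝ v a = 0 ∧
      e = inner ℝ e v • v + √(1 - (inner ℝ e v) ^ 2) • a := by
  set c : ℝ := inner ℝ e v with hc
  have hn : ‖e - c • v‖ ^ 2 = 1 - c ^ 2 := by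
    rw [norm_sub_sq_real, norm_smul, he, hv, inner_smul_right, ← hc, Real.norm_eq_abs, mul_one,
      sq_abs]
    ring
  have hn' : √(1 - c ^ 2) = ‖e - c • v‖ := by rw [← hn, Real.sqrt_sq (norm_nonneg _)]
  rw [hn']
  -- if `e = ± v`, any unit vector orthogonal to `v` will do
  by_cases h0 : e - c • v = 0
  · have hlt : Module.finrank ℝ (Submodule.span ℝ {v}) < Module.finrank ℝ E := by
      have := finrank_span_singleton (K := ℝ) (v := v) (by rintro rfl; simp at hv)
      omega
    have hne : (Submodule.span ℝ {v})ᗮ ≠ ⊥ := by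
      intro h
      have h1 := (Submodule.span ℝ {v}).finrank_add_finrank_orthogonal
      rw [h, finrank_bot] at h1
      omega
    obtain ⟨b, hb, hb0⟩ := Submodule.exists_mem_ne_zero_of_ne_bot hne
    refine ⟨‖b‖⁻¹ • b, ?_, ?_, ?_⟩
    · rw [norm_smul, norm_inv, norm_norm, inv_mul_cancel₀ (norm_ne_zero_iff.2 hb0)]
    · rw [inner_smul_right, Submodule.mem_orthogonal_singleton_iff_inner_right.1 hb, mul_zero]
    · rw [h0, norm_zero, zero_smul, add_zero]
      exact sub_eq_zero.1 h0
  · refine ⟨‖e - c • v‖⁻¹ • (e - c • v), ?_, ?_, ?_⟩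
    · rw [norm_smul, norm_inv, norm_norm, inv_mul_cancel₀ (norm_ne_zero_iff.2 h0)]
    · rw [inner_smul_right, inner_sub_right, inner_smul_right, real_inner_self_eq_norm_sq, hv,
        real_inner_comm, ← hc]
      ring
    · rw [smul_inv_smul₀ (norm_ne_zero_iff.2 h0)]
      abel

/-- Orthonormal coordinates on the hyperplane orthogonal to `v` whose first axis is `a`. -/
theorem exists_hyperplane_isometry {n m : ℕ} (hn : n = m + 2) {v a : EuclideanSpace ℝ (Fin n)}
    (hv : ‖v‖ = 1) (ha : ‖a‖ = 1) (hva : inner ℝ v a = 0) :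
    ∃ φ : EuclideanSpace ℝ (Fin m) →ₗᵢ[ℝ] EuclideanSpace ℝ (Fin n),
      (∀ z, inner ℝ v (φ z) = 0) ∧ (∀ z, inner ℝ a (φ z) = 0) ∧
      ∀ y, inner ℝ v y = 0 → inner ℝ a y = 0 → ∃ z, φ z = y := by
  set F : Submodule ℝ (EuclideanSpace ℝ (Fin n)) := Submodule.span ℝ {v, a} with hF
  have hon : Orthonormal ℝ ![v, a] := by
    rw [orthonormal_iff_ite]
    intro i k
    fin_cases i <;> fin_cases k <;>
      simp [hv, ha, hva, real_inner_comm]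
  have hfr : Module.finrank ℝ F = 2 := by
    have := finrank_span_eq_card hon.linearIndependent
    rwa [Matrix.range_cons_cons_empty, Fintype.card_fin] at this
  have hfo : Module.finrank ℝ Fᗮ = m := by
    have := F.finrank_add_finrank_orthogonal
    rw [hfr, finrank_euclideanSpace_fin] at this
    omega
  have hmem : ∀ y, y ∈ Fᗮ ↔ inner ℝ v y = 0 ∧ inner ℝ a y = 0 := by
    intro y
    rw [hF, Submodule.mem_orthogonal]
    constructor
    · exact fun h => ⟨h v (Submodule.subset_span (by simp)), h a (Submodule.subset_span (by simp))⟩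
    · rintro ⟨h1, h2⟩ u hu
      obtain ⟨p, r, rfl⟩ := Submodule.mem_span_pair.1 hu
      simp [inner_add_left, inner_smul_left, h1, h2]
  let ψ := ((stdOrthonormalBasis ℝ Fᗮ).reindex (finCongr hfo)).repr.symm
  refine ⟨Fᗮ.subtypeₗᵢ.comp ψ.toLinearIsometry, fun z => ((hmem _).1 (ψ z).2).1,
    fun z => ((hmem _).1 (ψ z).2).2, fun y h1 h2 => ?_⟩
  obtain ⟨z, hz⟩ := ψ.surjective ⟨y, (hmem y).2 ⟨h1, h2⟩⟩
  refine ⟨z, ?_⟩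
  change ((ψ z : Fᗮ) : EuclideanSpace ℝ (Fin n)) = y
  rw [hz]

/-- The section formula for a set with slope profile `Φ`. -/
theorem sectionVolume_eq_of_hasSlopeProfile {n m : ℕ} (hn : n = m + 2) (hm : 0 < m)
    {e v : EuclideanSpace ℝ (Fin n)} (he : ‖e‖ = 1) (hv : ‖v‖ = 1)
    {S : Set (EuclideanSpace ℝ (Fin n))} {Φ : ℝ → ℝ} (hΦ : Measurable Φ) (hΦ0 : ∀ x, 0 ≤ Φ x)
    (hS : HasSlopeProfile e S Φ) :
    sectionVolume S v = ENNReal.ofReal (sectionConst m) * ∫⁻ x, ENNReal.ofReal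
        ((Φ (x * √(1 - (inner ℝ e v) ^ 2) / √(1 + x ^ 2 * (inner ℝ e v) ^ 2))
          / √(1 + x ^ 2 * (inner ℝ e v) ^ 2)) ^ (m + 1)) := by
  obtain ⟨a, ha, hva, hea⟩ := exists_unit_orthogonal
    (by rw [finrank_euclideanSpace_fin]; omega) he hv
  obtain ⟨φ, hφv, hφa, hφs⟩ := exists_hyperplane_isometry hn hv ha hva
  set c : ℝ := inner ℝ e v with hc
  set s : ℝ := √(1 - c ^ 2) with hs
  have hc1 : c ^ 2 ≤ 1 := by
    have := abs_real_inner_le_norm e v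
    rw [he, hv, one_mul] at this
    rw [← sq_abs]
    exact pow_le_one₀ (abs_nonneg _) this
  have hs2 : s ^ 2 = 1 - c ^ 2 := Real.sq_sqrt (by linarith)
  have haa : inner ℝ a a = (1 : ℝ) := by rw [real_inner_self_eq_norm_sq, ha]; norm_num
  let L : WithLp 2 (ℝ × EuclideanSpace ℝ (Fin m)) →ₗ[ℝ] EuclideanSpace ℝ (Fin n) :=
    { toFun := fun p => p.fst • a + φ p.snd
      map_add' := fun p r => by simp [add_smul]; abel
      map_smul' := fun k p => by simp [mul_smul] }
  have hL : ∀ p, L p = p.fst • a + φ p.snd := fun p => rfl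
  have hnorm : ∀ p, ‖L p‖ ^ 2 = p.fst ^ 2 + ‖p.snd‖ ^ 2 := by
    intro p
    rw [hL, norm_add_sq_real, norm_smul, ha, inner_smul_left, hφa, φ.norm_map, Real.norm_eq_abs,
      mul_one, sq_abs]
    simp
  let ι : WithLp 2 (ℝ × EuclideanSpace ℝ (Fin m)) →ₗᵢ[ℝ] EuclideanSpace ℝ (Fin n) :=
    { toLinearMap := L
      norm_map' := fun p => by
        rw [← sq_eq_sq₀ (norm_nonneg _) (norm_nonneg _), hnorm, WithLp.prod_norm_sq_eq_of_L2,
          Real.norm_eq_abs, sq_abs] }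
  have hι : ∀ p, ι p = p.fst • a + φ p.snd := fun p => rfl
  have hrange : {y | inner ℝ v y = 0} = Set.range ι := by
    ext y
    constructor
    · intro (hy : inner ℝ v y = 0)
      obtain ⟨z, hz⟩ := hφs (y - inner ℝ a y • a)
        (by rw [inner_sub_right, inner_smul_right, hva, hy]; simp)
        (by rw [inner_sub_right, inner_smul_right, haa]; simp)
      refine ⟨WithLp.toLp 2 (inner ℝ a y, z), ?_⟩
      rw [hι]
      simp [hz]
    · rintro ⟨p, rfl⟩
      change inner ℝ v (ι p) = 0
      rw [hι, inner_add_right, inner_smul_right, hva, hφv]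
      simp
  have hinner : ∀ p, inner ℝ e (ι p) = p.fst * s := by
    intro p
    rw [hι, hea, inner_add_left, inner_smul_left, inner_smul_left, inner_add_right,
      inner_add_right, inner_smul_right, inner_smul_right, hva, hφv, hφa, haa]
    simp [mul_comm]
  have hdist : ∀ p, axialDist e (ι p) = √(p.fst ^ 2 * c ^ 2 + ‖p.snd‖ ^ 2) := by
    intro p
    rw [axialDist, hinner]
    congr 1
    change ‖L p‖ ^ 2 - _ = _
    rw [hnorm, mul_pow, hs2]
    ring
  have hfin : Module.finrank ℝ (WithLp 2 (ℝ × EuclideanSpace ℝ (Fin m))) = n - 1 := by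
    rw [(WithLp.linearEquiv 2 ℝ (ℝ × EuclideanSpace ℝ (Fin m))).finrank_eq,
      Module.finrank_prod, finrank_euclideanSpace_fin, Module.finrank_self]
    omega
  rw [sectionVolume, hrange, ← ι.isometry.euclideanHausdorffMeasure_preimage, ← hfin,
    InnerProductSpace.euclideanHausdorffMeasure_eq_volume,
    ← (WithLp.volume_preserving_toLp ℝ (EuclideanSpace ℝ (Fin m))).measure_preimage_emb
      (MeasurableEquiv.toLp 2 (ℝ × EuclideanSpace ℝ (Fin m))).measurableEmbedding,
    ← volume_slope_region hm hΦ hΦ0]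
  have : Nonempty (Fin m) := ⟨⟨0, hm⟩⟩
  -- only the points with `z ≠ 0` are certainly off the axis
  have hz : ∀ᵐ p : ℝ × EuclideanSpace ℝ (Fin m), p.2 ≠ 0 := by
    have : ∀ᵐ z : EuclideanSpace ℝ (Fin m), z ≠ 0 := by
      rw [ae_iff]
      simp
    exact (Measure.quasiMeasurePreserving_snd (μ := (volume : Measure ℝ))
      (ν := (volume : Measure (EuclideanSpace ℝ (Fin m))))).ae this
  apply measure_congr
  filter_upwards [hz] with p hp
  have hpos : 0 < axialDist e (ι (WithLp.toLp 2 p)) := by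
    rw [hdist]
    apply Real.sqrt_pos.2
    have : 0 < ‖p.2‖ := norm_pos_iff.2 hp
    simp only [WithLp.toLp_fst, WithLp.toLp_snd]
    positivity
  apply propext
  change ι (WithLp.toLp 2 p) ∈ S ↔ _
  rw [hS _ hpos, hdist, hinner]
  simp only [WithLp.toLp_fst, WithLp.toLp_snd]
  exact Iff.rfl

/-- The section formula with the slope as variable of integration, for hyperplanes other than the
orthogonal complement of the axis. -/
theorem sectionVolume_eq_of_axialDist_pos {n j : ℕ} (hn : n = j + 4) (hj : j ≠ 0)
    {e v : EuclideanSpace ℝ (Fin n)} (he : ‖e‖ = 1) (hv : ‖v‖ = 1) (hev : 0 < axialDist e v)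
    {S : Set (EuclideanSpace ℝ (Fin n))} {Φ : ℝ → ℝ} (hΦ : Measurable Φ) (hΦ0 : ∀ x, 0 ≤ Φ x)
    (hS : HasSlopeProfile e S Φ) :
    sectionVolume S v = ENNReal.ofReal (sectionConst (j + 2) * (axialDist e v)⁻¹) *
      ∫⁻ a, ENNReal.ofReal (Φ a ^ (j + 3) *
        √(1 - a ^ 2 * (inner ℝ e v / axialDist e v) ^ 2) ^ j) := by
  rw [sectionVolume_eq_of_hasSlopeProfile hn (by omega) he hv hΦ hΦ0 hS,
    ENNReal.ofReal_mul (sectionConst_pos (by omega)).le, mul_assoc]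
  congr 1
  have hs : √(1 - (inner ℝ e v) ^ 2) = axialDist e v := by rw [axialDist, hv, one_pow]
  rw [hs]
  set s := axialDist e v
  set c : ℝ := inner ℝ e v
  simp_rw [ENNReal.ofReal_mul (pow_nonneg (hΦ0 _) _)]
  rw [← lintegral_slope_subst _ _ hj, ← lintegral_comp_const_mul _ hev]
  refine lintegral_congr fun x => ?_
  rw [← ENNReal.ofReal_mul (pow_nonneg (hΦ0 _) _), ← mul_pow (Φ _), ← div_eq_mul_inv,
    show (s * x) ^ 2 * (c / s) ^ 2 = x ^ 2 * c ^ 2 by field_simp, mul_comm s x]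

/-- The intersection body of a body of revolution is a body of revolution, and its profile is the
transform of the power of the original profile. -/
theorem HasSlopeProfile.intersectionBody {n j : ℕ} (hn : n = j + 4) (hj : j ≠ 0)
    {e : EuclideanSpace ℝ (Fin n)} (he : ‖e‖ = 1)
    {S : Set (EuclideanSpace ℝ (Fin n))} {Φ : ℝ → ℝ} (hΦ : Measurable Φ) (hΦ0 : ∀ x, 0 ≤ Φ x)
    (hi : Integrable fun a => Φ a ^ (j + 3)) (hS : HasSlopeProfile e S Φ) :
    HasSlopeProfile e (intersectionBody S) fun b =>
      sectionConst (j + 2) * sectionTransform j (fun a => Φ a ^ (j + 3)) b := by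
  intro x hx
  have hx0 : x ≠ 0 := by
    rintro rfl
    simp [axialDist] at hx
  have hnx : 0 < ‖x‖ := norm_pos_iff.2 hx0
  set u := ‖x‖⁻¹ • x with hu
  have hu1 : ‖u‖ = 1 := by
    rw [hu, norm_smul, norm_inv, norm_norm, inv_mul_cancel₀ hnx.ne']
  have hinner : inner ℝ e u = inner ℝ e x / ‖x‖ := by
    rw [hu, inner_smul_right]; ring
  have hdist : axialDist e u = axialDist e x / ‖x‖ := by
    rw [axialDist, axialDist, hinner, hu1,
      show (1 : ℝ) ^ 2 - (inner ℝ e x / ‖x‖) ^ 2 = (‖x‖ ^ 2 - (inner ℝ e x) ^ 2) / ‖x‖ ^ 2 by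
        field_simp, Real.sqrt_div' _ (by positivity), Real.sqrt_sq hnx.le]
  have hsec : sectionVolume S x = sectionVolume S u :=
    (sectionVolume_smul S x (inv_ne_zero hnx.ne')).symm
  have hk := sectionConst_pos (m := j + 2) (by omega)
  have hd : 0 < axialDist e u := by rw [hdist]; positivity
  have hb : inner ℝ e u / axialDist e u = inner ℝ e x / axialDist e x := by
    rw [hinner, hdist]; field_simp
  change ENNReal.ofReal ‖x‖ ≤ sectionVolume S x ↔ _
  rw [hsec, sectionVolume_eq_of_axialDist_pos hn hj he hu1 hd hΦ hΦ0 hS, hb,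
    ← ofReal_integral_eq_lintegral_ofReal (integrable_mul_sqrt_pow hi j _)
      (Filter.Eventually.of_forall fun a => mul_nonneg (pow_nonneg (hΦ0 a) _) (by positivity)),
    ← ENNReal.ofReal_mul (by positivity)]
  change ENNReal.ofReal ‖x‖ ≤ ENNReal.ofReal (_ * sectionTransform j (fun a => Φ a ^ (j + 3)) _) ↔ _
  have h0 := sectionTransform_nonneg (D := fun a => Φ a ^ (j + 3))
    (fun a => pow_nonneg (hΦ0 a) _) j (inner ℝ e x / axialDist e x)
  rw [ENNReal.ofReal_le_ofReal_iff (by positivity), hdist, inv_div, mul_assoc, div_mul_eq_mul_div,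
    mul_div_assoc', le_div_iff₀ hx, mul_left_comm, mul_le_mul_iff_right₀ hnx]

/-- A symmetric convex body of revolution about `e` has the slope profile `1 / g`, where `g a` is
the gauge of a point of slope `a` at distance `1` from the axis. -/
theorem exists_convex_slopeProfile {n : ℕ} (hn : 2 ≤ n) {K : Set (EuclideanSpace ℝ (Fin n))}
    (hK : IsSymmetricConvexBody K) {e : EuclideanSpace ℝ (Fin n)} (he : ‖e‖ = 1)
    (hrev : ∀ x y, inner ℝ e x = inner ℝ e y → ‖x‖ = ‖y‖ → x ∈ K → y ∈ K) :
    ∃ g : ℝ → ℝ, ConvexOn ℝ Set.univ g ∧ Continuous g ∧ (∀ a, g (-a) = g a) ∧ (∀ a, 0 < g a) ∧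
      (∃ k > 0, ∀ a, k * a ≤ g a) ∧ HasSlopeProfile e K fun a => (g a)⁻¹ := by
  obtain ⟨w, hw, hew, -⟩ := exists_unit_orthogonal
    (by rw [finrank_euclideanSpace_fin]; exact hn) he he
  have hnhds : K ∈ nhds 0 := by
    obtain ⟨p, hp⟩ := hK.interior_nonempty
    have hp' : -p ∈ interior K := by
      have h1 : -K = K := by
        ext x
        exact ⟨fun h => by simpa using hK.symmetric _ h, fun h => hK.symmetric x h⟩
      have h2 : -p ∈ -interior K := by simpa using hp
      have h3 : -interior K = interior (-K) := (Homeomorph.neg _).preimage_interior K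
      rwa [h3, h1] at h2
    have := hK.convex.interior hp hp' (a := 1 / 2) (b := 1 / 2)
      (by norm_num) (by norm_num) (by norm_num)
    rw [smul_neg, add_neg_cancel] at this
    exact mem_interior_iff_mem_nhds.1 this
  have habs : Absorbent ℝ K := absorbent_nhds_zero hnhds
  have hmem : ∀ x, gauge K x ≤ 1 ↔ x ∈ K := by
    intro x
    rw [gauge_le_one_iff_mem_closure hK.convex hnhds, hK.isCompact.isClosed.closure_eq]
  obtain ⟨R, hR, hKR⟩ : ∃ R > 0, K ⊆ Metric.closedBall 0 R := by
    obtain ⟨R, hR⟩ := hK.isCompact.isBounded.subset_closedBall 0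
    exact ⟨max R 1, by positivity, hR.trans (Metric.closedBall_subset_closedBall (le_max_left _ _))⟩
  have hgauge : ∀ x, ‖x‖ / R ≤ gauge K x := fun x => le_gauge_of_subset_closedBall habs hR.le hKR
  have hinner : ∀ t r : ℝ, inner ℝ e (t • e + r • w) = t := by
    intro t r
    rw [inner_add_right, inner_smul_right, inner_smul_right, hew, real_inner_self_eq_norm_sq, he]
    ring
  have hnorm : ∀ t r : ℝ, ‖t • e + r • w‖ ^ 2 = t ^ 2 + r ^ 2 := by
    intro t r
    rw [norm_add_sq_real, norm_smul, norm_smul, inner_smul_left, inner_smul_right, hew, he, hw,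
      Real.norm_eq_abs, Real.norm_eq_abs, mul_one, mul_one, sq_abs, sq_abs]
    simp
  have hiff : ∀ x y, inner ℝ e x = inner ℝ e y → ‖x‖ ^ 2 = ‖y‖ ^ 2 → (x ∈ K ↔ y ∈ K) := by
    intro x y h1 h2
    rw [sq_eq_sq₀ (norm_nonneg _) (norm_nonneg _)] at h2
    exact ⟨hrev x y h1 h2, hrev y x h1.symm h2.symm⟩
  -- the gauge is invariant under the reflection in the axis hyperplane
  have hsymm : ∀ t r : ℝ, gauge K ((-t) • e + r • w) = gauge K (t • e + r • w) := by
    intro t r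
    have h1 : ∀ x, gauge K (-x) = gauge K x := gauge_neg hK.symmetric
    rw [← h1, gauge_def', gauge_def']
    congr 1
    ext l
    simp only [Set.mem_ofPred_eq, and_congr_right_iff]
    intro _
    apply hiff
    · rw [inner_smul_right, inner_smul_right, inner_neg_right, hinner, hinner, neg_neg]
    · rw [norm_smul, norm_smul, norm_neg, mul_pow, mul_pow, hnorm, hnorm, neg_sq]
  refine ⟨fun a => gauge K (a • e + (1 : ℝ) • w), ?_, ?_, fun a => hsymm a 1, fun a => ?_,
    ⟨R⁻¹, inv_pos.2 hR, fun a => ?_⟩, ?_⟩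
  · refine ⟨convex_univ, fun x _ y _ p q hp hq hpq => ?_⟩
    have h1 : (p • x + q • y) • e + (1 : ℝ) • w
        = p • (x • e + (1 : ℝ) • w) + q • (y • e + (1 : ℝ) • w) := by
      rw [show q = 1 - p by linarith]
      module
    beta_reduce
    rw [h1]
    refine (gauge_add_le hK.convex habs _ _).trans (le_of_eq ?_)
    rw [gauge_smul_of_nonneg hp, gauge_smul_of_nonneg hq]
  · exact (continuous_gauge hK.convex hnhds).comp (by fun_prop)
  · refine lt_of_lt_of_le (div_pos (norm_pos_iff.2 ?_) hR) (hgauge _)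
    intro h0
    have := hnorm a 1
    rw [h0, norm_zero] at this
    nlinarith [sq_nonneg a]
  · refine le_trans ?_ (hgauge _)
    rw [inv_mul_eq_div]
    gcongr
    refine (le_abs_self a).trans (abs_le_of_sq_le_sq ?_ (norm_nonneg _))
    rw [hnorm]
    linarith
  · intro x hx
    set r := axialDist e x with hr
    set t : ℝ := inner ℝ e x with ht
    have h1 : x ∈ K ↔ t • e + r • w ∈ K := by
      apply hiff
      · rw [hinner]
      · rw [hnorm, hr, axialDist_sq he]
        ring
    have h2 : t • e + r • w = r • ((t / r) • e + (1 : ℝ) • w) := by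
      rw [smul_add, smul_smul, smul_smul, mul_div_cancel₀ _ hx.ne', mul_one]
    have hg : 0 < gauge K ((t / r) • e + (1 : ℝ) • w) := by
      refine lt_of_lt_of_le (div_pos (norm_pos_iff.2 ?_) hR) (hgauge _)
      intro h0
      have := hnorm (t / r) 1
      rw [h0, norm_zero] at this
      nlinarith [sq_nonneg (t / r)]
    rw [h1, ← hmem, h2, gauge_smul_of_nonneg hx.le, smul_eq_mul]
    beta_reduce
    rw [← one_div, le_div_iff₀ hg]

/-! ### The second intersection body -/

/-- The volume of the section of `I K` by `x^⊥` is, up to a factor `1 + ε`, the radial function in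
the direction `x` of an ellipsoid of revolution. -/
theorem exists_sectionVolume_intersectionBody_bounds {ε : ℝ} (hε : 0 < ε) :
    ∃ N : ℕ, 2 ≤ N ∧ ∀ n : ℕ, N ≤ n → ∀ K : Set (EuclideanSpace ℝ (Fin n)),
      IsSymmetricConvexBody K → ∀ e : EuclideanSpace ℝ (Fin n), ‖e‖ = 1 →
      (∀ x y, inner ℝ e x = inner ℝ e y → ‖x‖ = ‖y‖ → x ∈ K → y ∈ K) →
      ∃ q > 0, ∃ R > 0, ∀ x, ‖x‖ = 1 →
        ENNReal.ofReal (R * (√((inner ℝ e x) ^ 2 + q * axialDist e x ^ 2))⁻¹)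
          ≤ sectionVolume (intersectionBody K) x ∧
        sectionVolume (intersectionBody K) x ≤ ENNReal.ofReal
          ((1 + ε) * R * (√((inner ℝ e x) ^ 2 + q * axialDist e x ^ 2))⁻¹) := by
  obtain ⟨j₀, hj₀⟩ := exists_ellipsoid_bounds_of_convex hε
  refine ⟨j₀ + 5, by omega, fun n hn K hK e he hrev => ?_⟩
  obtain ⟨j, rfl⟩ : ∃ j, n = j + 4 := ⟨n - 4, by omega⟩
  have hj : j ≠ 0 := by omega
  obtain ⟨g, hgc, hgcont, hge, hgpos, hgk, hprof⟩ :=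
    exists_convex_slopeProfile (by omega) hK he hrev
  set Ψ : ℝ → ℝ := sectionTransform j (fun a => (g a)⁻¹ ^ (j + 3)) with hΨ
  obtain ⟨hint, hΨ0, q, hq, hbd⟩ := hj₀ j (by omega) g hgc hgcont hge hgpos hgk Ψ hΨ
  have hginv : ∀ a, 0 ≤ (g a)⁻¹ := fun a => (inv_pos.2 (hgpos a)).le
  have hL : HasSlopeProfile e (intersectionBody K) fun b => sectionConst (j + 2) * Ψ b :=
    hprof.intersectionBody rfl hj he hgcont.measurable.inv hginv hint
  set k := sectionConst (j + 2) with hk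
  have hk0 : 0 < k := sectionConst_pos (by omega)
  have hΨm : Measurable Ψ :=
    measurable_sectionTransform (hgcont.measurable.inv.pow_const _) j
  have hΨnn : ∀ b, 0 ≤ Ψ b := sectionTransform_nonneg (fun a => pow_nonneg (hginv a) _) j
  have hΦm : Measurable fun b => k * Ψ b := hΨm.const_mul k
  have hΦnn : ∀ b, 0 ≤ k * Ψ b := fun b => mul_nonneg hk0.le (hΨnn b)
  set J := (ellipsoidConst (j + 3)).toReal with hJ
  have hJtop : ellipsoidConst (j + 3) ≠ ⊤ :=
    ((ellipsoidConst_le_pi (by omega)).trans_lt ENNReal.ofReal_lt_top).ne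
  have hJ0 : 0 < J := by
    refine ENNReal.toReal_pos (ne_of_gt ?_) hJtop
    exact (ENNReal.ofReal_pos.2 (by positivity)).trans_le (ellipsoidConst_ge (by omega))
  have hJe : ellipsoidConst (j + 3) = ENNReal.ofReal J := (ENNReal.ofReal_toReal hJtop).symm
  refine ⟨q, hq, k * (k ^ (j + 3) * (Ψ 0 ^ (j + 3) * J)), by positivity, fun v hv => ?_⟩
  have hsq := axialDist_sq he v
  rw [hv, one_pow] at hsq
  rcases (axialDist_nonneg e v).eq_or_lt with hs | hs
  · -- the hyperplane orthogonal to the axis: the section is a ball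
    rw [← hs] at hsq ⊢
    have hc : (inner ℝ e v) ^ 2 = (1 : ℝ) := by linarith
    have hsec : sectionVolume (intersectionBody K) v
        = ENNReal.ofReal (k * (k ^ (j + 3) * (Ψ 0 ^ (j + 3) * J))) := by
      rw [sectionVolume_eq_of_hasSlopeProfile (m := j + 2) rfl (by omega) he hv hΦm hΦnn hL, hc,
        ENNReal.ofReal_mul hk0.le, ← mul_assoc (k ^ (j + 3)), ENNReal.ofReal_mul (by positivity),
        ← hJe, ellipsoidConst,
        ← lintegral_const_mul' (ENNReal.ofReal (k ^ (j + 3) * Ψ 0 ^ (j + 3))) _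
          ENNReal.ofReal_ne_top]
      congr 1
      refine lintegral_congr fun x => ?_
      rw [← ENNReal.ofReal_mul (by positivity), ← mul_pow, ← mul_pow, ← div_eq_mul_inv]
      simp
    rw [hsec, hc]
    norm_num
    apply ENNReal.ofReal_le_ofReal
    exact le_mul_of_one_le_left (by positivity) (by linarith)
  · set s := axialDist e v
    set c : ℝ := inner ℝ e v
    have hroot : (√((c / s) ^ 2 + q))⁻¹ = s * (√(c ^ 2 + q * s ^ 2))⁻¹ := by
      have e1 : c ^ 2 + q * s ^ 2 = s ^ 2 * ((c / s) ^ 2 + q) := by field_simp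
      rw [e1, Real.sqrt_mul (by positivity), Real.sqrt_sq hs.le]
      field_simp
    obtain ⟨h1, h2⟩ := hbd (c / s)
    rw [hJe, hroot, ← ENNReal.ofReal_mul (by positivity)] at h1 h2
    have hsec : sectionVolume (intersectionBody K) v = ENNReal.ofReal (k * s⁻¹ * k ^ (j + 3)) *
        ∫⁻ a, ENNReal.ofReal (Ψ a ^ (j + 3) * √(1 - a ^ 2 * (c / s) ^ 2) ^ j) := by
      rw [sectionVolume_eq_of_axialDist_pos rfl hj he hv hs hΦm hΦnn hL,
        ENNReal.ofReal_mul (p := k * s⁻¹) (by positivity), mul_assoc,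
        ← lintegral_const_mul' (ENNReal.ofReal (k ^ (j + 3))) _ ENNReal.ofReal_ne_top]
      congr 1
      refine lintegral_congr fun a => ?_
      rw [← ENNReal.ofReal_mul (by positivity), mul_pow, mul_assoc]
    rw [hsec]
    constructor
    · refine le_trans (le_of_eq ?_) (mul_le_mul_right h1 _)
      rw [← ENNReal.ofReal_mul (by positivity)]
      congr 1
      field_simp
    · refine (mul_le_mul_right h2 _).trans (le_of_eq ?_)
      rw [← ENNReal.ofReal_mul (by positivity)]
      congr 1
      field_simp

/-- An ellipsoid of revolution is a linear image of the unit ball. -/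
theorem exists_linearEquiv_image_closedBall {E : Type*} [NormedAddCommGroup E]
    [InnerProductSpace ℝ E] {e : E} (he : ‖e‖ = 1) {q R : ℝ} (hq : 0 < q) (hR : 0 < R) :
    ∃ T : E ≃ₗ[ℝ] E, T '' Metric.closedBall 0 1
      = {x | √((inner ℝ e x) ^ 2 + q * axialDist e x ^ 2) ≤ R} := by
  have hq' : 0 < √q := Real.sqrt_pos.2 hq
  have hee : inner ℝ e e = (1 : ℝ) := by rw [real_inner_self_eq_norm_sq, he]; norm_num
  let A : ℝ → ℝ → E →ₗ[ℝ] E := fun α β =>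
    { toFun := fun x => β • x + ((α - β) * inner ℝ e x) • e
      map_add' := fun x y => by rw [inner_add_right]; module
      map_smul' := fun r x => by
        rw [inner_smul_right, RingHom.id_apply]
        module }
  have hA : ∀ α β x, A α β x = β • x + ((α - β) * inner ℝ e x) • e := fun _ _ _ => rfl
  have hcomp : ∀ α β α' β' x, α * α' = 1 → β * β' = 1 → A α β (A α' β' x) = x := by
    intro α β α' β' x h1 h2
    rw [hA, hA, inner_add_right, inner_smul_right, inner_smul_right, hee, smul_add, smul_smul,
      smul_smul, h2, one_smul, add_assoc, ← add_smul]
    rw [show β * ((α' - β') * inner ℝ e x) +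
        (α - β) * (β' * inner ℝ e x + (α' - β') * inner ℝ e x * 1) = 0 by
      linear_combination (inner ℝ e x) * h1 - (inner ℝ e x) * h2]
    rw [zero_smul, add_zero]
  have hnorm : ∀ x, ‖A R⁻¹ (√q * R⁻¹) x‖ ^ 2
      = (R⁻¹) ^ 2 * ((inner ℝ e x) ^ 2 + q * axialDist e x ^ 2) := by
    intro x
    rw [hA, norm_add_sq_real, norm_smul, norm_smul, inner_smul_left, inner_smul_right, he,
      axialDist_sq he, mul_pow, mul_pow, Real.norm_eq_abs, Real.norm_eq_abs, sq_abs, sq_abs,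
      real_inner_comm e x]
    simp only [conj_trivial]
    linear_combination (R⁻¹ ^ 2 * (‖x‖ ^ 2 - (inner ℝ e x) ^ 2)) * Real.sq_sqrt hq.le
  let T : E ≃ₗ[ℝ] E :=
    { A R (R * (√q)⁻¹) with
      invFun := A R⁻¹ (√q * R⁻¹)
      left_inv := fun x => hcomp _ _ _ _ x (by field_simp) (by field_simp)
      right_inv := fun x => hcomp _ _ _ _ x (by field_simp) (by field_simp) }
  refine ⟨T, ?_⟩
  rw [LinearEquiv.image_eq_preimage_symm]
  ext x
  have h1 : T.symm x = A R⁻¹ (√q * R⁻¹) x := rfl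
  rw [Set.mem_preimage, mem_closedBall_zero_iff, h1, Set.mem_ofPred_eq, Real.sqrt_le_left hR.le,
    ← sq_le_one_iff₀ (norm_nonneg _), hnorm, inv_pow, inv_mul_le_one₀ (by positivity)]

theorem mainTheorem2 (ε : ℝ) (hε : 0 < ε) :
    ∃ N : ℕ, 0 < N ∧ ∀ n : ℕ, N ≤ n → ∀ K : Set (EuclideanSpace ℝ (Fin n)),
      IsSymmetricConvexBody K → IsOfRevolution K →
        banachMazurDist (intersectionBody (intersectionBody K))
          (Metric.closedBall (0 : EuclideanSpace ℝ (Fin n)) 1) ≤ ENNReal.ofReal (1 + ε) := by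
  obtain ⟨N, hN, H⟩ := exists_sectionVolume_intersectionBody_bounds hε
  refine ⟨N, by omega, fun n hn K hK ⟨e, he, hrev⟩ => ?_⟩
  obtain ⟨q, hq, R, hR, hsec⟩ := H n hn K hK e he hrev
  obtain ⟨T, hT⟩ := exists_linearEquiv_image_closedBall he hq
    (mul_pos (by linarith : 0 < 1 + ε) hR)
  set Q : EuclideanSpace ℝ (Fin n) → ℝ :=
    fun x => √((inner ℝ e x) ^ 2 + q * axialDist e x ^ 2) with hQ
  have hQsmul : ∀ (r : ℝ) x, 0 ≤ r → Q (r • x) = r * Q x := by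
    intro r x hr
    simp only [hQ, axialDist_sq he, inner_smul_right, norm_smul, Real.norm_of_nonneg hr]
    rw [show (r * inner ℝ e x) ^ 2 + q * ((r * ‖x‖) ^ 2 - (r * inner ℝ e x) ^ 2)
      = r ^ 2 * ((inner ℝ e x) ^ 2 + q * (‖x‖ ^ 2 - (inner ℝ e x) ^ 2)) by ring,
      Real.sqrt_mul (sq_nonneg r), Real.sqrt_sq hr]
  have hQpos : ∀ x, x ≠ 0 → 0 < Q x := by
    intro x hx
    apply Real.sqrt_pos.2
    by_cases h0 : (inner ℝ e x : ℝ) = 0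
    · have := norm_pos_iff.2 hx
      rw [axialDist_sq he, h0]
      ring_nf
      positivity
    · positivity
  -- for `x = ‖x‖ • u`, both bounds can be read off from those in the unit direction `u`
  have hray : ∀ x, x ≠ 0 → ‖‖x‖⁻¹ • x‖ = 1 ∧ Q (‖x‖⁻¹ • x) = ‖x‖⁻¹ * Q x ∧
      sectionVolume (intersectionBody K) x
        = sectionVolume (intersectionBody K) (‖x‖⁻¹ • x) := by
    intro x hx
    have hnx := norm_pos_iff.2 hx
    refine ⟨?_, hQsmul _ _ (inv_pos.2 hnx).le, (sectionVolume_smul _ x (inv_pos.2 hnx).ne').symm⟩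
    rw [norm_smul, norm_inv, norm_norm, inv_mul_cancel₀ hnx.ne']
  have hin : ∀ x, Q x ≤ R → x ∈ intersectionBody (intersectionBody K) := by
    intro x hx
    change ENNReal.ofReal ‖x‖ ≤ sectionVolume (intersectionBody K) x
    by_cases h0 : x = 0
    · simp [h0]
    have hnx := norm_pos_iff.2 h0
    have hQx := hQpos x h0
    obtain ⟨h1, h2, h3⟩ := hray x h0
    rw [h3]
    refine le_trans (ENNReal.ofReal_le_ofReal ?_) (hsec _ h1).1
    change ‖x‖ ≤ R * (Q (‖x‖⁻¹ • x))⁻¹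
    rw [h2, mul_inv, inv_inv, mul_left_comm, ← div_eq_mul_inv]
    exact le_mul_of_one_le_right hnx.le ((one_le_div hQx).2 hx)
  have hout : ∀ x ∈ intersectionBody (intersectionBody K), Q x ≤ (1 + ε) * R := by
    intro x (hx : ENNReal.ofReal ‖x‖ ≤ sectionVolume (intersectionBody K) x)
    by_cases h0 : x = 0
    · have h1 : Q x = 0 := by
        have := hQsmul 0 x le_rfl
        rwa [zero_smul, zero_mul, ← h0] at this
      rw [h1]
      positivity
    have hnx := norm_pos_iff.2 h0
    have hQx := hQpos x h0
    obtain ⟨h1, h2, h3⟩ := hray x h0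
    rw [h3] at hx
    have h4 := hx.trans (hsec _ h1).2
    change ENNReal.ofReal ‖x‖ ≤ ENNReal.ofReal ((1 + ε) * R * (Q (‖x‖⁻¹ • x))⁻¹) at h4
    rw [h2, ENNReal.ofReal_le_ofReal_iff (by positivity), mul_inv, inv_inv, mul_left_comm,
      ← div_eq_mul_inv, le_mul_iff_one_le_right hnx, one_le_div hQx] at h4
    exact h4
  refine sInf_le ⟨1 + ε, by linarith, rfl, T, ?_, ?_⟩
  · rw [hT]
    exact hout
  · rw [hT]
    intro x (hx : Q x ≤ (1 + ε) * R)
    refine ⟨(1 + ε)⁻¹ • x, hin _ ?_, smul_inv_smul₀ (by positivity) x⟩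
    rw [hQsmul _ _ (by positivity), inv_mul_le_iff₀ (by positivity)]
    exact hx
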